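/- Let $F=\mathbb F_q$ be a finite field, $K$ a field, $n\ge 0$, and let $\mathcal C\subseteq F^n$ be a linear code of dimension $k\ge 1$. **Codes.** For $c\in F^n$ let $\operatorname{supp}(c)=\{i: c_i\ne 0\}$; for a subspace $D\subseteq F^n$ let $w(D)$ be the number of coordinates at which some element of $D$ is nonzero. For $1\le r\le k$ let $d_r(\mathcal C)=\min\{w(D): D\subseteq\mathcal C \text{ a subspace},\ \dim D=r\}$. A nonzero codeword has *minimal support* if no nonzero codeword has a support properly contained in its support. **The ideal $I(\mathcal C)$.** Consider the polynomial ring $K[\mathbf x]$ in the indeterminates $x_{i,\gamma}$ with $1\le i\le n$ and $\gamma\in F\setminus\{0\}$. For $a\in F^n$ put $\mathbf x^{\Delta a}=\prod_{i:\,a_i\neq 0}x_{i,a_i}$, and let $$I(\mathcal C)=\langle \mathbf x^{\Delta a}-\mathbf x^{\Delta b} : a-b\in\mathcal C\rangle .$$ Let $\mathcal R$ be the ideal generated by all $x_{i,\gamma}x_{i,\delta}-x_{i,\gamma+\delta}$ with $\gamma+\delta\ne0$ and all $x_{i,\gamma}x_{i,-\gamma}-1$. Fix a monomial order $\prec$ on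 $K[\mathbf x]$ that is degree compatible (monomials of smaller total degree are smaller) and satisfies $x_{i',\gamma'}\prec x_{i,\gamma}$ whenever $i<i'$. Order $F^n$ by $a\prec b\iff \mathbf x^{\Delta a}\prec\mathbf x^{\Delta b}$. Let $\mathcal G$ be the reduced Gröbner basis of $I(\mathcal C)$ with respect to $\prec$, and let $M_{\mathcal G}$ be the set of codewords of minimal support of the form $a-b$, where $\mathbf x^{\Delta a}-\mathbf x^{\Delta b}\in\mathcal G\setminus\mathcal R$ and $\mathbf x^{\Delta b}\prec\mathbf x^{\Delta a}$. **Betti numbers.** Let $R=K[x_1,\dots,x_n]$ with the standard grading and $I_{M_{\mathcal G}}=\langle \prod_{i\in\operatorname{supp}(c)}x_i : c\in M_{\mathcal G}\rangle\subseteq R$. Then $R/I_{M_{\mathcal G}}$ has a minimal graded free resolution; for any such resolution $\cdots\to F_1\to F_0\to R/I_{M_{\mathcal G}}\to0$ write $F_i=\bigoplus_j R(-j)^{\beta_{i,j}}$. The following hold. 1. $d_1(\mathcal C)=\min\{j:\beta_{1,j}(R/I_{M_{\mathcal G}})\neq 0\}$. 2. Suppose that $k\ge2$ and that $\prec$ also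 satisfies: if $a,b\in F^n$ have disjoint supports and $\mathbf x^{\Delta b}\prec\mathbf x^{\Delta a}$, then $\mathbf x^{\Delta(-b)}\prec\mathbf x^{\Delta(-a)}$. Let $m_1$ be the $\prec$-least element of $\{m\in\mathcal C\setminus\{0\}: \exists\, m'\in\mathcal C,\ w(\langle m,m'\rangle)=d_2(\mathcal C)\}$, let $m_2$ be the $\prec$-least element of $\{m\in\mathcal C: w(\langle m_1,m\rangle)=d_2(\mathcal C)\}$, and put $\mathcal I=\operatorname{supp}(m_1)$, $\mathcal J=\operatorname{supp}(m_2)$. If $|\mathcal I\cap \mathcal J|\le\frac{|\mathcal J|+1}{2}$, then $d_2(\mathcal C)=\min\{j:\beta_{2,j}(R/I_{M_{\mathcal G}})\ne0\}$. In particular both minima are over nonempty sets. -/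

import Mathlib

open scoped MonomialOrder

noncomputable section

namespace LinearCodeBetti

/-! ### Linear codes and generalized Hamming weights -/

section Codes

variable {F : Type*} [Field F] {n : ℕ}

/-- The support of a word, as a finite set of coordinates. -/
def supp (c : Fin n → F) : Finset (Fin n) :=
  (Set.toFinite {i | c i ≠ 0}).toFinset

/-- The support of a subspace `D`: the coordinates at which some element of `D` is nonzero. -/
def suppSub (D : Submodule F (Fin n → F)) : Finset (Fin n) :=
  (Set.toFinite {i | ∃ c ∈ D, i ∈ supp c}).toFinset

/-- The `r`-th generalized Hamming weight: the least weight of an `r`-dimensional subspace of `C`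
(meaningful for `1 ≤ r ≤ dim C`). -/
def ghw (C : Submodule F (Fin n → F)) (r : ℕ) : ℕ :=
  sInf {w | ∃ D : Submodule F (Fin n → F), D ≤ C ∧ Module.finrank F D = r ∧
    (suppSub D).card = w}

/-- The set of codewords of minimal support. -/
def minSupportWords (C : Submodule F (Fin n → F)) : Set (Fin n → F) :=
  {c | c ∈ C ∧ c ≠ 0 ∧ ∀ c' ∈ C, c' ≠ 0 → ¬ supp c' ⊂ supp c}

end Codes

/-! ### The binomial ideal of a code

The indeterminates over the `i`-th coordinate are indexed by the nonzero elements of `F`: once a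
primitive element `α` is fixed, the indeterminate `x_{i,j}` is `X (i, α ^ j)`. -/

section BinomialIdeal

variable {F : Type*} [Field F] [Finite F] {n : ℕ}

open Classical in
/-- The exponent vector `Δ a`: its block at coordinate `i` is the unit vector of `a i` if
`a i ≠ 0`, and zero otherwise. -/
def expo (a : Fin n → F) : Fin n × Fˣ →₀ ℕ :=
  Finsupp.equivFunOnFinite.symm fun p => if a p.1 = (p.2 : F) then 1 else 0

variable (K : Type*) [Field K]

/-- The monomial `x ^ Δ a`. -/
def wordMonomial (a : Fin n → F) : MvPolynomial (Fin n × Fˣ) K :=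
  MvPolynomial.monomial (expo a) 1

/-- The ideal generated by all `x ^ Δ a - x ^ Δ b` with `a - b ∈ C`. -/
def codeIdeal (C : Submodule F (Fin n → F)) : Ideal (MvPolynomial (Fin n × Fˣ) K) :=
  Ideal.span {f | ∃ a b : Fin n → F, a - b ∈ C ∧ f = wordMonomial K a - wordMonomial K b}

variable (F n) in
/-- The sum over all coordinates `i` of the ideals encoding the addition table of `F` in the
indeterminates of the `i`-th block. -/
def additionIdeal : Ideal (MvPolynomial (Fin n × Fˣ) K) :=
  ⨆ i : Fin n,
    (Ideal.span {f | ∃ u v w : Fˣ, (u : F) + v = w ∧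
        f = MvPolynomial.X (i, u) * MvPolynomial.X (i, v) - MvPolynomial.X (i, w)} ⊔
      Ideal.span {f | ∃ u v : Fˣ, (u : F) + v = 0 ∧
        f = MvPolynomial.X (i, u) * MvPolynomial.X (i, v) - 1})

end BinomialIdeal

/-! ### Gröbner bases -/

section Groebner

variable {σ K : Type*} [Field K]

/-- The initial ideal, generated by the initial monomials of the nonzero elements of `I`. -/
def initialIdeal (ord : MonomialOrder σ) (I : Ideal (MvPolynomial σ K)) :
    Ideal (MvPolynomial σ K) :=
  Ideal.span {t | ∃ f ∈ I, f ≠ 0 ∧ t = MvPolynomial.monomial (ord.degree f) 1}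

/-- `G` is the reduced Gröbner basis of `I`. -/
structure IsReducedGroebnerBasis (ord : MonomialOrder σ) (I : Ideal (MvPolynomial σ K))
    (G : Set (MvPolynomial σ K)) : Prop where
  finite : G.Finite
  subset : G ⊆ I
  span_initial :
    initialIdeal ord I = Ideal.span {t | ∃ g ∈ G, t = MvPolynomial.monomial (ord.degree g) 1}
  monic : ∀ g ∈ G, ord.Monic g
  reduced : ∀ g ∈ G, ∀ g' ∈ G, g ≠ g' → ∀ s ∈ g'.support, ¬ ord.degree g ≤ s

/-- The order refines the total degree. -/
def DegreeCompatible (ord : MonomialOrder σ) : Prop :=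
  ∀ s t : σ →₀ ℕ, s.degree < t.degree → s ≺[ord] t

end Groebner

section GroebnerWords

variable {F : Type*} [Field F] [Finite F] {n : ℕ}

/-- `X_n ≺ ⋯ ≺ X_1`: every indeterminate of a later block is smaller than every indeterminate of
an earlier block. -/
def BlockDecreasing (ord : MonomialOrder (Fin n × Fˣ)) : Prop :=
  ∀ i i' : Fin n, i < i' → ∀ u u' : Fˣ,
    (Finsupp.single (i', u') 1 : Fin n × Fˣ →₀ ℕ) ≺[ord] Finsupp.single (i, u) 1

/-- For words with disjoint supports, `x ^ Δ b ≺ x ^ Δ a` implies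
`x ^ Δ (-b) ≺ x ^ Δ (-a)`. -/
def NegCompatible (ord : MonomialOrder (Fin n × Fˣ)) : Prop :=
  ∀ a b : Fin n → F, Disjoint (supp a) (supp b) →
    expo b ≺[ord] expo a → expo (-b) ≺[ord] expo (-a)

/-- `m` is the least element of `S` for the order on words `a ≺ b ↔ x ^ Δ a ≺ x ^ Δ b`. -/
def IsLeastWord (ord : MonomialOrder (Fin n × Fˣ)) (S : Set (Fin n → F)) (m : Fin n → F) : Prop :=
  m ∈ S ∧ ∀ m' ∈ S, expo m ≼[ord] expo m'

/-- The set `M_G`: codewords of minimal support of the form `c_g = a - b` for some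
`g = x ^ Δ a - x ^ Δ b ∈ G` outside the addition ideal, where `x ^ Δ b ≺ x ^ Δ a`. -/
def groebnerWords {K : Type*} [Field K] (ord : MonomialOrder (Fin n × Fˣ))
    (C : Submodule F (Fin n → F)) (G : Set (MvPolynomial (Fin n × Fˣ) K)) : Set (Fin n → F) :=
  {c | c ∈ C ∧ ∃ a b : Fin n → F,
      wordMonomial K a - wordMonomial K b ∈ G ∧
      wordMonomial K a - wordMonomial K b ∉ additionIdeal F n K ∧
      expo b ≺[ord] expo a ∧ a - b = c} ∩ minSupportWords C

/-- The nonzero codewords `m` such that `⟨m, m'⟩` has weight `d_2(C)` for some codeword `m'`. -/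
def firstWords (C : Submodule F (Fin n → F)) : Set (Fin n → F) :=
  {m | m ∈ C ∧ m ≠ 0 ∧ ∃ m' ∈ C, ghw C 2 = (suppSub (Submodule.span F {m, m'})).card}

/-- The codewords `m` such that `⟨m₁, m⟩` has weight `d_2(C)`. -/
def secondWords (C : Submodule F (Fin n → F)) (m₁ : Fin n → F) : Set (Fin n → F) :=
  {m | m ∈ C ∧ ghw C 2 = (suppSub (Submodule.span F {m₁, m})).card}

end GroebnerWords

/-! ### Monomial ideals and graded Betti numbers -/

section Betti

variable {n : ℕ}

/-- The square-free monomial ideal of `K[x_1, …, x_n]` generated by the monomials `x ^ supp c`,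
`c ∈ M`. -/
def supportIdeal {F : Type*} [Field F] (K : Type*) [Field K] (M : Set (Fin n → F)) :
    Ideal (MvPolynomial (Fin n) K) :=
  Ideal.span {t | ∃ c ∈ M, t = ∏ i ∈ supp c, MvPolynomial.X i}

/-- A minimal graded free resolution `⋯ → F_2 → F_1 → F_0 → R / I → 0` over `R = K[x_1, …, x_n]`.
The module `F_i` is free on a finite basis, whose `k`-th element has degree `deg i k`, that is
`F_i = ⨁ₖ R(-deg i k)`; all maps are homogeneous of degree `0`, the sequence is exact, and
`d i : F_{i+1} → F_i` has its image in `(x_1, …, x_n) F_i`. -/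
structure MinimalGradedFreeResolution {K : Type*} [Field K]
    (I : Ideal (MvPolynomial (Fin n) K)) where
  rank : ℕ → ℕ
  deg : (i : ℕ) → Fin (rank i) → ℕ
  d : (i : ℕ) → (Fin (rank (i + 1)) → MvPolynomial (Fin n) K) →ₗ[MvPolynomial (Fin n) K]
    (Fin (rank i) → MvPolynomial (Fin n) K)
  aug : (Fin (rank 0) → MvPolynomial (Fin n) K) →ₗ[MvPolynomial (Fin n) K]
    (MvPolynomial (Fin n) K ⧸ I)
  d_homogeneous : ∀ i k l, ∀ s ∈ (d i (Pi.single k 1) l).support,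
    s.degree + deg i l = deg (i + 1) k
  aug_homogeneous : ∀ k, ∃ p : MvPolynomial (Fin n) K,
    p.IsHomogeneous (deg 0 k) ∧ aug (Pi.single k 1) = Ideal.Quotient.mk I p
  exact : ∀ i, Function.Exact (d (i + 1)) (d i)
  exact_aug : Function.Exact (d 0) aug
  aug_surjective : Function.Surjective aug
  minimal : ∀ i k l, MvPolynomial.constantCoeff (d i (Pi.single k 1) l) = 0

/-- The graded Betti number `β_{i,j}`: the number of summands `R(-j)` of `F_i`. -/
def MinimalGradedFreeResolution.betti {K : Type*} [Field K]
    {I : Ideal (MvPolynomial (Fin n) K)} (P : MinimalGradedFreeResolution I) (i j : ℕ) : ℕ :=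
  (Finset.univ.filter fun k => P.deg i k = j).card

end Betti

end LinearCodeBetti

end

open LinearCodeBetti

/-!
The exponent vectors of words are a section of the additive map sending a monomial to the word that
it represents, and for a degree compatible order they are the least monomials over their words. So
the standard monomials of the ideal of the code include the monomials of the coset leaders, and
`a - b` comes from the Gröbner basis whenever `b` is the leader of the coset of `a` and `a` becomes
a leader as soon as one of its nonzero entries is erased.

A word of least weight realizing `d_1`, or enlarging the support of `m₁` as little as possible, is
split as `a - b` into halves of almost equal weight; for the second word the bound on the overlap
allows `a` to cover the overlap with `supp m₁`. Taking the pair with the least product of monomials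
makes the larger of the two halves minimal among non-leaders, and subtracting its leader gives a
word of the same kind from the Gröbner basis. For `m₁` itself the same construction yields a
multiple of `m₁`, as otherwise a smaller first word would exist.

On the algebraic side, the degrees of the minimal generators of a graded module begin with the least
degree of a nonzero homogeneous element. Applied to a square-free monomial ideal and to its
relations, whose multidegrees are all divisible by the least common multiple of two generators, this
gives the least `|S|` and the least `|S ∪ T|` over distinct supports `S` and `T`.
-/

namespace LinearCodeBetti

noncomputable section

/-! ### Supports and generalized Hamming weights -/

section Codes

variable {F : Type*} [Field F] {n : ℕ}

@[simp]
lemma mem_supp {c : Fin n → F} {i : Fin n} : i ∈ supp c ↔ c i ≠ 0 := by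
  simp [supp]

lemma supp_add_subset (a b : Fin n → F) : supp (a + b) ⊆ supp a ∪ supp b := by
  intro i
  simp only [mem_supp, Finset.mem_union, Pi.add_apply]
  contrapose!
  rintro ⟨ha, hb⟩
  simp [ha, hb]

@[simp]
lemma supp_neg (a : Fin n → F) : supp (-a) = supp a := by
  ext i
  simp

lemma supp_sub_subset (a b : Fin n → F) : supp (a - b) ⊆ supp a ∪ supp b := by
  simpa [sub_eq_add_neg] using supp_add_subset a (-b)

lemma card_supp_sub_le (a b : Fin n → F) : (supp (a - b)).card ≤ (supp a).card + (supp b).card :=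
  (Finset.card_le_card (supp_sub_subset a b)).trans (Finset.card_union_le _ _)

lemma supp_smul {t : F} (ht : t ≠ 0) (a : Fin n → F) : supp (t • a) = supp a := by
  ext i
  simp [ht]

lemma supp_smul_subset (t : F) (a : Fin n → F) : supp (t • a) ⊆ supp a := by
  intro i
  simp only [mem_supp, Pi.smul_apply, smul_eq_mul]
  exact right_ne_zero_of_mul

lemma supp_eq_of_mem_span_singleton {m x : Fin n → F} (h : x ∈ Submodule.span F {m})
    (hx : x ≠ 0) : supp x = supp m := by
  obtain ⟨t, rfl⟩ := Submodule.mem_span_singleton.mp h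
  exact supp_smul (left_ne_zero_of_smul hx) m

lemma supp_nonempty {a : Fin n → F} (ha : a ≠ 0) : (supp a).Nonempty := by
  obtain ⟨i, hi⟩ := Function.ne_iff.mp ha
  exact ⟨i, mem_supp.mpr hi⟩

@[simp]
lemma supp_zero : supp (0 : Fin n → F) = ∅ := by
  ext i
  simp

lemma supp_single {i : Fin n} {t : F} (ht : t ≠ 0) : supp (Pi.single i t) = {i} := by
  ext j
  rcases eq_or_ne j i with rfl | h <;> simp [*]

lemma exists_smul_sub_ssubset_union {x : Fin n → F} (hx : x ≠ 0) (y : Fin n → F) :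
    ∃ t : F, supp (y - t • x) ⊂ supp x ∪ supp y := by
  obtain ⟨i, hi⟩ := supp_nonempty hx
  refine ⟨y i / x i, Finset.ssubset_iff_subset_ne.mpr ⟨?_, fun h => ?_⟩⟩
  · rw [Finset.union_comm]
    exact (supp_sub_subset _ _).trans (Finset.union_subset_union_right (supp_smul_subset _ _))
  · have : i ∈ supp (y - (y i / x i) • x) := h ▸ Finset.mem_union_left _ hi
    simp [div_mul_cancel₀ _ (mem_supp.mp hi)] at this

/-- The word `a` with its `i`-th entry replaced by zero. -/
abbrev erase (a : Fin n → F) (i : Fin n) : Fin n → F := Function.update a i 0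

lemma supp_erase (a : Fin n → F) (i : Fin n) : supp (erase a i) = (supp a).erase i := by
  ext j
  rcases eq_or_ne j i with rfl | h <;> simp [*]

lemma card_supp_erase {a : Fin n → F} {i : Fin n} (hi : i ∈ supp a) :
    (supp (erase a i)).card + 1 = (supp a).card := by
  rw [supp_erase, Finset.card_erase_add_one hi]

lemma single_add_erase (a : Fin n → F) (i : Fin n) : Pi.single i (a i) + erase a i = a := by
  ext j
  rcases eq_or_ne j i with rfl | h <;> simp [*]

lemma disjoint_single_erase (a : Fin n → F) (i : Fin n) :
    Disjoint (supp (Pi.single i (a i))) (supp (erase a i)) := by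
  rw [Finset.disjoint_left]
  intro j hj
  rcases eq_or_ne j i with rfl | h
  · simp
  · simp [h] at hj

lemma word_induction {P : (Fin n → F) → Prop} (h0 : P 0)
    (hs : ∀ (a : Fin n → F) (i : Fin n), a i ≠ 0 → P (erase a i) → P a) (a : Fin n → F) : P a := by
  induction h : (supp a).card generalizing a with
  | zero =>
    suffices a = 0 from this ▸ h0
    by_contra ha
    exact (supp_nonempty ha).card_pos.ne' h
  | succ k ih =>
    obtain ⟨i, hi⟩ := Finset.card_pos.mp (h.symm ▸ k.succ_pos : 0 < (supp a).card)
    exact hs a i (mem_supp.mp hi) (ih _ (by have := card_supp_erase hi; omega))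

open Classical in
lemma exists_eq_sub_of_subset_supp (m : Fin n → F) {T : Finset (Fin n)} (hT : T ⊆ supp m) :
    ∃ a b : Fin n → F, m = a - b ∧ supp a = T ∧ supp b = supp m \ T := by
  refine ⟨fun i => if i ∈ T then m i else 0, fun i => if i ∈ T then 0 else -m i, ?_, ?_, ?_⟩
  · ext i
    by_cases h : i ∈ T <;> simp [h]
  · ext i
    by_cases h : i ∈ T
    · simpa [h] using hT h
    · simp [h]
  · ext i
    by_cases h : i ∈ T <;> simp [h]

lemma exists_balanced_split (m : Fin n → F) {S : Finset (Fin n)} (hS : S ⊆ supp m)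
    (hcard : 2 * S.card ≤ (supp m).card + 1) :
    ∃ a b : Fin n → F, m = a - b ∧ Disjoint (supp a) (supp b) ∧ supp a ∪ supp b = supp m ∧
      S ⊆ supp a ∧ (supp b).card ≤ (supp a).card ∧ (supp a).card ≤ (supp b).card + 1 := by
  obtain ⟨T, hST, hTm, hT⟩ := Finset.exists_subsuperset_card_eq (n := ((supp m).card + 1) / 2) hS
    (by omega) (by omega)
  obtain ⟨a, b, hm, ha, hb⟩ := exists_eq_sub_of_subset_supp m hTm
  have hcb := Finset.card_sdiff_of_subset hTm
  rw [← ha] at hTm hT hST hb hcb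
  exact ⟨a, b, hm, hb ▸ Finset.disjoint_sdiff, by rw [hb, Finset.union_sdiff_of_subset hTm], hST,
    by rw [hb]; omega, by rw [hb]; omega⟩

variable {C D : Submodule F (Fin n → F)}

@[simp]
lemma mem_suppSub {i : Fin n} : i ∈ suppSub D ↔ ∃ c ∈ D, i ∈ supp c := by
  simp [suppSub]

lemma supp_subset_suppSub {c : Fin n → F} (hc : c ∈ D) : supp c ⊆ suppSub D :=
  fun _ hi => mem_suppSub.mpr ⟨c, hc, hi⟩

@[simp]
lemma suppSub_bot : suppSub (⊥ : Submodule F (Fin n → F)) = ∅ := by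
  ext i
  simp

lemma suppSub_span_pair (x y : Fin n → F) :
    suppSub (Submodule.span F {x, y}) = supp x ∪ supp y := by
  refine Finset.Subset.antisymm (fun i hi => ?_) (Finset.union_subset
    (supp_subset_suppSub (Submodule.mem_span_of_mem (by simp)))
    (supp_subset_suppSub (Submodule.mem_span_of_mem (by simp))))
  obtain ⟨c, hc, hi⟩ := mem_suppSub.mp hi
  obtain ⟨s, t, rfl⟩ := Submodule.mem_span_pair.mp hc
  exact Finset.union_subset_union (supp_smul_subset _ _) (supp_smul_subset _ _)
    (supp_add_subset _ _ hi)

lemma suppSub_span_singleton (x : Fin n → F) : suppSub (Submodule.span F {x}) = supp x := by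
  simpa using suppSub_span_pair x x

lemma suppSub_union_supp_congr {x y : Fin n → F} (h : x - y ∈ D) :
    suppSub D ∪ supp x = suppSub D ∪ supp y := by
  have key : ∀ x y : Fin n → F, x - y ∈ D → suppSub D ∪ supp x ⊆ suppSub D ∪ supp y := by
    intro x y h
    refine Finset.union_subset Finset.subset_union_left ?_
    rw [← sub_add_cancel x y]
    exact (supp_add_subset _ _).trans (Finset.union_subset_union_left (supp_subset_suppSub h))
  exact (key x y h).antisymm (key y x (by simpa using D.neg_mem h))

lemma card_suppSub_union_supp_sub_le (D : Submodule F (Fin n → F)) (a b : Fin n → F) :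
    (suppSub D ∪ supp (a - b)).card ≤ (suppSub D ∪ supp a).card + (supp b).card := by
  refine (Finset.card_le_card ?_).trans (Finset.card_union_le _ _)
  rw [Finset.union_assoc]
  exact Finset.union_subset_union_right (supp_sub_subset a b)

lemma ghw_le {r : ℕ} (hD : D ≤ C) (hr : Module.finrank F D = r) :
    ghw C r ≤ (suppSub D).card :=
  Nat.sInf_le ⟨D, hD, hr, rfl⟩

lemma exists_card_suppSub_eq_ghw {r : ℕ} (hr : r ≤ Module.finrank F C) :
    ∃ D ≤ C, Module.finrank F D = r ∧ (suppSub D).card = ghw C r := by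
  obtain ⟨f, hf⟩ := exists_linearIndependent_of_le_finrank hr
  have hspan : Submodule.span F (Set.range (C.subtype ∘ f)) ≤ C := by
    rw [Submodule.span_le]
    rintro _ ⟨i, rfl⟩
    exact (f i).2
  have hrank := finrank_span_eq_card (hf.map' C.subtype (Submodule.ker_subtype C))
  rw [Fintype.card_fin] at hrank
  exact Nat.sInf_mem (s := {w | ∃ D ≤ C, Module.finrank F D = r ∧ (suppSub D).card = w})
    ⟨_, _, hspan, hrank, rfl⟩

lemma ghw_one_le {c : Fin n → F} (hc : c ∈ C) (h0 : c ≠ 0) : ghw C 1 ≤ (supp c).card := by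
  rw [← suppSub_span_singleton]
  exact ghw_le (by simpa using hc) (finrank_span_singleton h0)

lemma exists_card_supp_eq_ghw_one (hC : 1 ≤ Module.finrank F C) :
    ∃ c ∈ C, c ≠ 0 ∧ (supp c).card = ghw C 1 := by
  obtain ⟨D, hDC, hD, hw⟩ := exists_card_suppSub_eq_ghw hC
  obtain ⟨c, hc, h0⟩ := D.exists_mem_ne_zero_of_ne_bot (by rintro rfl; simp at hD)
  exact ⟨c, hDC hc, h0, le_antisymm (hw ▸ Finset.card_le_card (supp_subset_suppSub hc))
    (ghw_one_le (hDC hc) h0)⟩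

lemma ghw_two_le {x y : Fin n → F} (hxC : x ∈ C) (hyC : y ∈ C) (hx : x ≠ 0)
    (hy : y ∉ Submodule.span F {x}) : ghw C 2 ≤ (supp x ∪ supp y).card := by
  rw [← suppSub_span_pair]
  refine ghw_le (Submodule.span_le.mpr (Set.pair_subset hxC hyC)) ?_
  have hli : LinearIndependent F ![x, y] := (LinearIndependent.pair_iff' hx).mpr fun t ht =>
    hy (Submodule.mem_span_singleton.mpr ⟨t, ht⟩)
  rw [← Matrix.range_cons_cons_empty x y ![]]
  exact finrank_span_eq_card hli

lemma exists_card_supp_union_eq_ghw_two (hC : 2 ≤ Module.finrank F C) :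
    ∃ x ∈ C, ∃ y ∈ C, x ≠ 0 ∧ y ∉ Submodule.span F {x} ∧
      (supp x ∪ supp y).card = ghw C 2 := by
  obtain ⟨D, hDC, hD, hw⟩ := exists_card_suppSub_eq_ghw hC
  obtain ⟨x, hx, hx0⟩ := D.exists_mem_ne_zero_of_ne_bot (by rintro rfl; simp at hD)
  obtain ⟨y, hy, hyx⟩ : ∃ y ∈ D, y ∉ Submodule.span F {x} := by
    refine SetLike.not_le_iff_exists.mp fun hle => ?_
    have := Submodule.finrank_mono hle
    rw [hD, finrank_span_singleton hx0] at this
    omega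
  refine ⟨x, hDC hx, y, hDC hy, hx0, hyx, le_antisymm (hw ▸ Finset.card_le_card ?_)
    (ghw_two_le (hDC hx) (hDC hy) hx0 hyx)⟩
  exact Finset.union_subset (supp_subset_suppSub hx) (supp_subset_suppSub hy)

lemma mem_minSupportWords_of_card_lt_ghw_two {c : Fin n → F} (hc : c ∈ C) (h0 : c ≠ 0)
    (h : (supp c).card < ghw C 2) : c ∈ minSupportWords C := by
  refine ⟨hc, h0, fun c' hc' h0' hlt => ?_⟩
  by_cases hspan : c' ∈ Submodule.span F {c}
  · exact hlt.ne (supp_eq_of_mem_span_singleton hspan h0')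
  · have := ghw_two_le hc hc' h0 hspan
    rw [Finset.union_eq_left.mpr hlt.subset] at this
    omega

end Codes

/-! ### Exponent vectors of words -/

section Expo

variable (F : Type*) [Field F] (n : ℕ) in
/-- The word `∑ s (i, u) • u eᵢ` represented by the monomial with exponent vector `s`. -/
def word : (Fin n × Fˣ →₀ ℕ) →+ (Fin n → F) :=
  Finsupp.liftAddHom fun p => multiplesHom (Fin n → F) (Pi.single p.1 (p.2 : F))

variable {F : Type*} [Field F] {n : ℕ}

@[simp]
lemma word_single (p : Fin n × Fˣ) (k : ℕ) :
    word F n (Finsupp.single p k) = k • Pi.single p.1 (p.2 : F) := by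
  simp [word]

variable [Finite F]

open Classical in
lemma expo_apply (a : Fin n → F) (p : Fin n × Fˣ) :
    expo a p = if a p.1 = (p.2 : F) then 1 else 0 := rfl

lemma expo_add_of_disjoint {a b : Fin n → F} (h : Disjoint (supp a) (supp b)) :
    expo (a + b) = expo a + expo b := by
  ext ⟨i, u⟩
  have hi : a i = 0 ∨ b i = 0 := by
    by_contra! hc
    exact Finset.disjoint_left.mp h (mem_supp.mpr hc.1) (mem_supp.mpr hc.2)
  rw [Finsupp.add_apply, expo_apply, expo_apply, expo_apply, Pi.add_apply]
  rcases hi with hi | hi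
  · rw [hi, zero_add, if_neg u.ne_zero.symm, zero_add]
  · rw [hi, add_zero, if_neg u.ne_zero.symm, add_zero]

@[simp]
lemma expo_zero : expo (0 : Fin n → F) = 0 := by
  ext ⟨i, u⟩
  simp [expo_apply, u.ne_zero.symm]

lemma expo_single (i : Fin n) (u : Fˣ) :
    expo (Pi.single i (u : F)) = Finsupp.single (i, u) 1 := by
  classical
  ext ⟨j, v⟩
  rcases eq_or_ne j i with rfl | h
  · simp [expo_apply, Finsupp.single_apply, Units.ext_iff]
  · simp [expo_apply, h, v.ne_zero.symm]

lemma expo_eq_single_add_expo_erase {a : Fin n → F} {i : Fin n} (hi : a i ≠ 0) :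
    expo a = Finsupp.single (i, Units.mk0 _ hi) 1 + expo (erase a i) := by
  conv_lhs => rw [← single_add_erase a i]
  rw [expo_add_of_disjoint (disjoint_single_erase a i), ← expo_single, Units.val_mk0]

@[simp]
lemma degree_expo (a : Fin n → F) : (expo a).degree = (supp a).card := by
  induction a using word_induction with
  | h0 => simp
  | hs a i hi ih =>
    rw [expo_eq_single_add_expo_erase hi, map_add, ih, Finsupp.degree_single, add_comm,
      card_supp_erase (mem_supp.mpr hi)]

@[simp]
lemma word_expo (a : Fin n → F) : word F n (expo a) = a := by
  induction a using word_induction with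
  | h0 => simp
  | hs a i hi ih =>
    rw [expo_eq_single_add_expo_erase hi, map_add, ih, word_single, one_smul, Units.val_mk0,
      single_add_erase]

lemma expo_injective : Function.Injective (expo : (Fin n → F) → _) :=
  Function.LeftInverse.injective word_expo

lemma exists_le_expo_erase {a : Fin n → F} {s : Fin n × Fˣ →₀ ℕ} (h : s < expo a) :
    ∃ i ∈ supp a, s ≤ expo (erase a i) := by
  classical
  obtain ⟨⟨i, u⟩, hp⟩ : ∃ p, s p < expo a p := by
    by_contra! hle
    exact h.not_ge hle
  have hau : a i = u := by
    by_contra hne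
    simp [expo_apply, hne] at hp
  have hi : a i ≠ 0 := hau ▸ u.ne_zero
  have hu : Units.mk0 _ hi = u := Units.ext hau
  refine ⟨i, mem_supp.mpr hi, fun p => ?_⟩
  have hle := h.le p
  rw [expo_eq_single_add_expo_erase hi, hu] at hp hle
  rcases eq_or_ne p (i, u) with rfl | hne
  · simp [expo_apply, u.ne_zero.symm] at hp
    simp [hp]
  · simpa [Finsupp.single_eq_of_ne hne] using hle

variable {ord : MonomialOrder (Fin n × Fˣ)}

lemma expo_lt_or_gt {a b : Fin n → F} (h : a ≠ b) :
    expo a ≺[ord] expo b ∨ expo b ≺[ord] expo a :=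
  lt_or_gt_of_ne fun h' => h (expo_injective (ord.toSyn.injective h'))

lemma card_supp_le_of_expo_le (hdeg : DegreeCompatible ord) {a b : Fin n → F}
    (h : expo a ≼[ord] expo b) : (supp a).card ≤ (supp b).card := by
  by_contra! hlt
  exact (hdeg (expo b) (expo a) (by simpa using hlt)).not_ge h

lemma expo_add_le (hdeg : DegreeCompatible ord) (a b : Fin n → F) :
    expo (a + b) ≼[ord] expo a + expo b := by
  by_cases h : Disjoint (supp a) (supp b)
  · rw [expo_add_of_disjoint h]
  · refine (hdeg _ _ ?_).le
    rw [map_add, degree_expo, degree_expo, degree_expo]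
    have hsub := Finset.card_le_card (supp_add_subset a b)
    have hunion := Finset.card_union_add_card_inter (supp a) (supp b)
    have hinter := Finset.card_pos.mpr (Finset.not_disjoint_iff_nonempty_inter.mp h)
    omega

lemma expo_word_le (hdeg : DegreeCompatible ord) (s : Fin n × Fˣ →₀ ℕ) :
    expo (word F n s) ≼[ord] s := by
  have hadd : ∀ s t : Fin n × Fˣ →₀ ℕ, expo (word F n s) ≼[ord] s → expo (word F n t) ≼[ord] t →
      expo (word F n (s + t)) ≼[ord] s + t := by
    intro s t hs ht
    rw [map_add]
    refine (expo_add_le hdeg _ _).trans ?_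
    rw [map_add, map_add]
    exact add_le_add hs ht
  induction s using Finsupp.induction_linear with
  | zero => simp
  | add s t hs ht => exact hadd s t hs ht
  | single p k =>
    induction k with
    | zero => simp
    | succ k ih =>
      rw [Finsupp.single_add]
      refine hadd _ _ ih ?_
      rw [word_single, one_smul, expo_single]

lemma expo_single_add_lt (hdeg : DegreeCompatible ord) {a y : Fin n → F} {i : Fin n}
    (h : expo y ≺[ord] expo (erase a i)) : expo (Pi.single i (a i) + y) ≺[ord] expo a := by
  refine (expo_add_le hdeg _ _).trans_lt ?_
  conv_rhs => rw [← single_add_erase a i, expo_add_of_disjoint (disjoint_single_erase a i)]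
  rw [map_add, map_add]
  exact add_lt_add_right h _

end Expo

/-! ### Reduced Gröbner bases and standard monomials -/

section ReducedGroebnerBasis

variable {σ K : Type*} [Field K] {ord : MonomialOrder σ} {I : Ideal (MvPolynomial σ K)}
  {G : Set (MvPolynomial σ K)}

/-- `s` is the exponent vector of a standard monomial of `I`: one outside the initial ideal. -/
def IsStandard (ord : MonomialOrder σ) (I : Ideal (MvPolynomial σ K)) (s : σ →₀ ℕ) : Prop :=
  ∀ f ∈ I, f ≠ 0 → ¬ ord.degree f ≤ s

lemma IsStandard.mono {s t : σ →₀ ℕ} (ht : IsStandard ord I t) (hst : s ≤ t) :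
    IsStandard ord I s :=
  fun f hf h0 hle => ht f hf h0 (hle.trans hst)

lemma isStandard_of_forall_degree_ne {s : σ →₀ ℕ} (h : ∀ f ∈ I, f ≠ 0 → ord.degree f ≠ s) :
    IsStandard ord I s := by
  intro f hf h0 hle
  refine h (MvPolynomial.monomial (s - ord.degree f) 1 * f) (I.mul_mem_left _ hf)
    (mul_ne_zero (by simp) h0) ?_
  classical
  rw [ord.degree_mul (by simp) h0, ord.degree_monomial, if_neg one_ne_zero,
    tsub_add_cancel_of_le hle]

lemma IsReducedGroebnerBasis.exists_degree_le (hG : IsReducedGroebnerBasis ord I G)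
    {f : MvPolynomial σ K} (hf : f ∈ I) (h0 : f ≠ 0) :
    ∃ g ∈ G, ord.degree g ≤ ord.degree f := by
  classical
  have hmem : MvPolynomial.monomial (ord.degree f) (1 : K) ∈ initialIdeal ord I :=
    Ideal.subset_span ⟨f, hf, h0, rfl⟩
  have himage : {t | ∃ g ∈ G, t = MvPolynomial.monomial (ord.degree g) (1 : K)} =
      (fun s => MvPolynomial.monomial s 1) '' (ord.degree '' G) := by
    ext t
    simp [eq_comm]
  rw [hG.span_initial, himage, MvPolynomial.mem_ideal_span_monomial_image] at hmem
  obtain ⟨_, ⟨g, hg, rfl⟩, hle⟩ := hmem (ord.degree f) (by simp [MvPolynomial.mem_support_iff])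
  exact ⟨g, hg, hle⟩

lemma IsReducedGroebnerBasis.mem (hG : IsReducedGroebnerBasis ord I G) {f : MvPolynomial σ K}
    (hf : f ∈ I) (hmonic : ord.Monic f) (hlead : ∀ s < ord.degree f, IsStandard ord I s)
    (htail : ∀ s ∈ f.support, s ≠ ord.degree f → IsStandard ord I s) : f ∈ G := by
  classical
  obtain ⟨g, hg, hle⟩ := hG.exists_degree_le hf hmonic.ne_zero
  have hgmonic := hG.monic g hg
  have hgI : g ∈ I := hG.subset hg
  have hdeg : ord.degree g = ord.degree f :=
    hle.eq_of_not_lt fun hlt => hlead _ hlt g hgI hgmonic.ne_zero le_rfl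
  suffices g = f from this ▸ hg
  by_contra hne
  have hr0 : g - f ≠ 0 := sub_ne_zero.mpr hne
  have hrI : g - f ∈ I := I.sub_mem hgI hf
  have hr := ord.degree_mem_support hr0
  set t := ord.degree (g - f)
  have htf : t ≠ ord.degree f := by
    intro h
    rw [MvPolynomial.mem_support_iff, h, MvPolynomial.coeff_sub, hmonic.coeff_degree, ← hdeg,
      hgmonic.coeff_degree, sub_self] at hr
    exact hr rfl
  rcases Finset.mem_union.mp (MvPolynomial.support_sub _ _ _ hr) with htg | ht
  · obtain ⟨g', hg', hle'⟩ := hG.exists_degree_le hrI hr0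
    have hgg : g' = g := by
      by_contra hgg
      exact hG.reduced g' hg' g hg hgg t htg hle'
    subst hgg
    exact htf (hdeg ▸ ord.toSyn.injective ((ord.le_degree htg).antisymm (ord.toSyn_monotone hle')))
  · exact htail t ht htf _ hrI hr0 le_rfl

end ReducedGroebnerBasis

/-! ### The reduced Gröbner basis of the ideal of a code -/

section CodeIdeal

variable {F : Type*} [Field F] {n : ℕ} (K : Type*) [Field K]

/-- The homomorphism from the polynomial ring to the group algebra of `Fⁿ / C` sending a monomial
to the class of the word that it represents. Its kernel contains the ideal of the code. -/
def cosetHom (C : Submodule F (Fin n → F)) :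
    MvPolynomial (Fin n × Fˣ) K →ₐ[K] AddMonoidAlgebra K ((Fin n → F) ⧸ C) :=
  AddMonoidAlgebra.mapDomainAlgHom K K (C.mkQ.toAddMonoidHom.comp (word F n))

variable {K}

lemma cosetHom_monomial (C : Submodule F (Fin n → F)) (s : Fin n × Fˣ →₀ ℕ) (k : K) :
    cosetHom K C (MvPolynomial.monomial s k) =
      AddMonoidAlgebra.single (C.mkQ (word F n s)) k :=
  AddMonoidAlgebra.mapDomain_single

lemma cosetHom_X (C : Submodule F (Fin n → F)) (p : Fin n × Fˣ) :
    cosetHom K C (MvPolynomial.X p) =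
      AddMonoidAlgebra.single (C.mkQ (Pi.single p.1 (p.2 : F))) 1 := by
  rw [MvPolynomial.X, cosetHom_monomial, word_single, one_smul]

lemma cosetHom_ne_zero (C : Submodule F (Fin n → F)) {f : MvPolynomial (Fin n × Fˣ) K}
    {s : Fin n × Fˣ →₀ ℕ} (hs : s ∈ f.support)
    (h : ∀ t ∈ f.support, word F n s - word F n t ∈ C → t = s) : cosetHom K C f ≠ 0 := by
  intro h0
  have hcoeff := congrArg (fun x => x.coeff (C.mkQ (word F n s))) h0
  rw [f.as_sum, map_sum] at hcoeff
  simp only [cosetHom_monomial, AddMonoidAlgebra.coeff_sum, Finsupp.finsetSum_apply,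
    AddMonoidAlgebra.coeff_single, AddMonoidAlgebra.coeff_zero, Finsupp.zero_apply] at hcoeff
  rw [Finset.sum_eq_single_of_mem s hs, Finsupp.single_eq_same] at hcoeff
  · exact MvPolynomial.mem_support_iff.mp hs hcoeff
  · intro t ht hts
    exact Finsupp.single_eq_of_ne fun he => hts (h t ht ((Submodule.Quotient.eq C).mp he))

lemma additionIdeal_le_ker :
    additionIdeal F n K ≤ RingHom.ker (cosetHom K (⊥ : Submodule F (Fin n → F))) := by
  refine iSup_le fun i => sup_le (Ideal.span_le.mpr ?_) (Ideal.span_le.mpr ?_)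
  · rintro _ ⟨u, v, w, h, rfl⟩
    simp only [SetLike.mem_coe, RingHom.mem_ker, map_sub, map_mul, cosetHom_X,
      AddMonoidAlgebra.single_mul_single, ← map_add, ← Pi.single_add, h, mul_one, sub_self]
  · rintro _ ⟨u, v, h, rfl⟩
    simp only [SetLike.mem_coe, RingHom.mem_ker, map_sub, map_mul, map_one, cosetHom_X,
      AddMonoidAlgebra.single_mul_single, ← map_add, ← Pi.single_add, h, mul_one, Pi.single_zero,
      map_zero, ← AddMonoidAlgebra.one_def, sub_self]

variable [Finite F]

lemma cosetHom_wordMonomial_sub_eq_zero_iff {C : Submodule F (Fin n → F)} {a b : Fin n → F} :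
    cosetHom K C (wordMonomial K a - wordMonomial K b) = 0 ↔ a - b ∈ C := by
  rw [map_sub, wordMonomial, wordMonomial, cosetHom_monomial, cosetHom_monomial, word_expo,
    word_expo, sub_eq_zero, AddMonoidAlgebra.single_left_inj one_ne_zero]
  exact Submodule.Quotient.eq C

lemma codeIdeal_le_ker (C : Submodule F (Fin n → F)) :
    codeIdeal K C ≤ RingHom.ker (cosetHom K C) := by
  refine Ideal.span_le.mpr ?_
  rintro _ ⟨a, b, hab, rfl⟩
  exact cosetHom_wordMonomial_sub_eq_zero_iff.mpr hab

lemma wordMonomial_sub_notMem_additionIdeal {a b : Fin n → F} (hab : a ≠ b) :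
    wordMonomial K a - wordMonomial K b ∉ additionIdeal F n K := fun h =>
  hab (sub_eq_zero.mp ((Submodule.mem_bot F).mp
    (cosetHom_wordMonomial_sub_eq_zero_iff.mp (additionIdeal_le_ker h))))

variable {ord : MonomialOrder (Fin n × Fˣ)} {C : Submodule F (Fin n → F)} {a b : Fin n → F}

/-- The coset leaders of a code: the words that are least in their coset modulo `C`. -/
def IsCosetLeader (ord : MonomialOrder (Fin n × Fˣ)) (C : Submodule F (Fin n → F))
    (a : Fin n → F) : Prop :=
  ∀ b, a - b ∈ C → expo a ≼[ord] expo b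

lemma exists_isCosetLeader (ord : MonomialOrder (Fin n × Fˣ)) (C : Submodule F (Fin n → F))
    (a : Fin n → F) : ∃ b, a - b ∈ C ∧ IsCosetLeader ord C b := by
  obtain ⟨b, hb, hmin⟩ := (InvImage.wf (fun b : Fin n → F => ord.toSyn (expo b))
    wellFounded_lt).has_min {b | a - b ∈ C} ⟨a, by simp⟩
  exact ⟨b, hb, fun c hc => not_lt.mp (hmin c (by simpa using C.add_mem hb hc))⟩

lemma IsCosetLeader.isStandard (hdeg : DegreeCompatible ord) (ha : IsCosetLeader ord C a) :
    IsStandard ord (codeIdeal K C) (expo a) := by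
  refine isStandard_of_forall_degree_ne fun f hf h0 hd => ?_
  refine cosetHom_ne_zero C (ord.degree_mem_support h0) (fun t ht htC => ?_)
    (codeIdeal_le_ker C hf)
  rw [hd, word_expo] at htC
  have hle : ord.degree f ≼[ord] t := hd ▸ (ha _ htC).trans (expo_word_le hdeg t)
  exact ord.toSyn.injective ((ord.le_degree ht).antisymm hle)

/-- The words that are not coset leaders, but become so whenever one of their nonzero entries is
erased. They parametrize the leading monomials of the Gröbner basis outside the addition ideal. -/
structure IsMinimalNonleader (ord : MonomialOrder (Fin n × Fˣ)) (C : Submodule F (Fin n → F))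
    (a : Fin n → F) : Prop where
  not_isCosetLeader : ¬ IsCosetLeader ord C a
  isCosetLeader_erase : ∀ i ∈ supp a, IsCosetLeader ord C (erase a i)

lemma IsMinimalNonleader.wordMonomial_sub_mem (hdeg : DegreeCompatible ord)
    {G : Set (MvPolynomial (Fin n × Fˣ) K)} (hG : IsReducedGroebnerBasis ord (codeIdeal K C) G)
    (ha : IsMinimalNonleader ord C a) (hb : IsCosetLeader ord C b) (hab : a - b ∈ C)
    (hlt : expo b ≺[ord] expo a) : wordMonomial K a - wordMonomial K b ∈ G := by
  classical
  have hdeg_word : ∀ c : Fin n → F, ord.degree (wordMonomial K c) = expo c := fun c => by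
    rw [wordMonomial, ord.degree_monomial, if_neg one_ne_zero]
  have hlt' : ord.degree (wordMonomial K b) ≺[ord] ord.degree (wordMonomial K a) := by
    rwa [hdeg_word, hdeg_word]
  have hd : ord.degree (wordMonomial K a - wordMonomial K b) = expo a := by
    rw [ord.degree_sub_of_lt hlt', hdeg_word]
  refine hG.mem (Ideal.subset_span ⟨a, b, hab, rfl⟩) ?_ (fun s hs => ?_) fun s hs hsd => ?_
  · rw [MonomialOrder.Monic, ord.leadingCoeff_sub_of_lt hlt', wordMonomial,
      ord.leadingCoeff_monomial]
  · obtain ⟨i, hi, hle⟩ := exists_le_expo_erase (hd ▸ hs)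
    exact ((ha.isCosetLeader_erase i hi).isStandard hdeg).mono hle
  · have hs' : s = expo a ∨ s = expo b := by
      simpa [wordMonomial] using Finset.union_subset_union MvPolynomial.support_monomial_subset
        MvPolynomial.support_monomial_subset (MvPolynomial.support_sub _ _ _ hs)
    exact hs'.resolve_left (hd ▸ hsd) ▸ hb.isStandard hdeg

lemma IsMinimalNonleader.sub_mem_groebnerWords (hdeg : DegreeCompatible ord)
    {G : Set (MvPolynomial (Fin n × Fˣ) K)} (hG : IsReducedGroebnerBasis ord (codeIdeal K C) G)
    (ha : IsMinimalNonleader ord C a) (hb : IsCosetLeader ord C b)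
    (hmin : a - b ∈ minSupportWords C) : a - b ∈ groebnerWords ord C G := by
  have hne : a ≠ b := fun h => ha.not_isCosetLeader (h ▸ hb)
  have hlt : expo b ≺[ord] expo a := by
    refine (expo_lt_or_gt hne).resolve_left fun hlt => ha.not_isCosetLeader fun c hc => ?_
    exact hlt.le.trans (hb c (by simpa using C.sub_mem hc hmin.1))
  exact ⟨⟨hmin.1, a, b, ha.wordMonomial_sub_mem hdeg hG hb hmin.1 hlt,
    wordMonomial_sub_notMem_additionIdeal hne, hlt, rfl⟩, hmin⟩

end CodeIdeal

/-! ### Words of minimal weight relative to a subspace -/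

section RelativelyMinimal

variable {F : Type*} [Field F] {n : ℕ} {C D : Submodule F (Fin n → F)} {m a b : Fin n → F}

/-- A codeword outside `D` that enlarges the support of `D` as little as possible and has least
weight among these. For `D = ⊥` these are the codewords of minimum weight; for `D = ⟨m₁⟩` they are
the candidates for a second generator of a two-dimensional subcode of least weight. -/
structure IsRelativelyMinimal (C D : Submodule F (Fin n → F)) (m : Fin n → F) : Prop where
  mem : m ∈ C
  notMem : m ∉ D
  card_union_le : ∀ x ∈ C, x ∉ D → (suppSub D ∪ supp m).card ≤ (suppSub D ∪ supp x).card
  card_le : ∀ x ∈ C, x ∉ D → (suppSub D ∪ supp x).card ≤ (suppSub D ∪ supp m).card →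
    (supp m).card ≤ (supp x).card

namespace IsRelativelyMinimal

lemma of_card_le (hm : IsRelativelyMinimal C D m) {c : Fin n → F} (hc : c ∈ C) (hcD : c ∉ D)
    (hunion : (suppSub D ∪ supp c).card ≤ (suppSub D ∪ supp m).card)
    (hcard : (supp c).card ≤ (supp m).card) : IsRelativelyMinimal C D c where
  mem := hc
  notMem := hcD
  card_union_le x hx hxD := hunion.trans (hm.card_union_le x hx hxD)
  card_le x hx hxD h := hcard.trans (hm.card_le x hx hxD (h.trans hunion))

lemma card_union_eq (hm : IsRelativelyMinimal C D m) {c : Fin n → F}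
    (hc : IsRelativelyMinimal C D c) :
    (suppSub D ∪ supp c).card = (suppSub D ∪ supp m).card :=
  (hc.card_union_le m hm.mem hm.notMem).antisymm (hm.card_union_le c hc.mem hc.notMem)

lemma mem_minSupportWords (hm : IsRelativelyMinimal C D m) : m ∈ minSupportWords C := by
  have not_ssubset : ∀ x ∈ C, x ∉ D → ¬ supp x ⊂ supp m := fun x hx hxD hlt =>
    (Finset.card_lt_card hlt).not_ge (hm.card_le x hx hxD
      (Finset.card_le_card (Finset.union_subset_union_right hlt.subset)))
  refine ⟨hm.mem, fun h => hm.notMem (h ▸ D.zero_mem), fun c hc hc0 hlt => ?_⟩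
  by_cases hcD : c ∈ D
  · obtain ⟨t, ht⟩ := exists_smul_sub_ssubset_union hc0 m
    rw [Finset.union_eq_right.mpr hlt.subset] at ht
    refine not_ssubset _ (C.sub_mem hm.mem (C.smul_mem t hc)) (fun h => hm.notMem ?_) ht
    simpa using D.add_mem h (D.smul_mem t hcD)
  · exact not_ssubset c hc hcD hlt

end IsRelativelyMinimal

/-- A splitting `a - b` of a relatively minimal word into two halves of almost equal weight, where
`b` accounts for coordinates outside the support of `D` only. -/
structure IsBalancedPair (C D : Submodule F (Fin n → F)) (m a b : Fin n → F) : Prop where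
  mem : a - b ∈ C
  notMem : a - b ∉ D
  card_union : (suppSub D ∪ supp a).card + (supp b).card = (suppSub D ∪ supp m).card
  card_add : (supp a).card + (supp b).card = (supp m).card
  le : (supp b).card ≤ (supp a).card
  le_succ : (supp a).card ≤ (supp b).card + 1

lemma IsRelativelyMinimal.exists_isBalancedPair (hm : IsRelativelyMinimal C D m)
    (hinter : 2 * (suppSub D ∩ supp m).card ≤ (supp m).card + 1) :
    ∃ a b, IsBalancedPair C D m a b := by
  obtain ⟨a, b, rfl, hdisj, hab, hS, hle, hle'⟩ :=
    exists_balanced_split m Finset.inter_subset_right hinter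
  have hcard : (supp a).card + (supp b).card = (supp (a - b)).card := by
    rw [← hab, Finset.card_union_of_disjoint hdisj]
  refine ⟨a, b, hm.mem, hm.notMem, ?_, hcard, hle, hle'⟩
  rw [← hab, ← Finset.union_assoc]
  refine (Finset.card_union_of_disjoint ?_).symm
  refine Finset.disjoint_union_left.mpr ⟨Finset.disjoint_left.mpr fun i hiD hib => ?_, hdisj⟩
  have hi := hS (Finset.mem_inter.mpr ⟨hiD, hab ▸ Finset.mem_union_right _ hib⟩)
  exact Finset.disjoint_left.mp hdisj hi hib

lemma IsBalancedPair.of_card_le (hm : IsRelativelyMinimal C D m) (hab : IsBalancedPair C D m a b)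
    {x y : Fin n → F} (hmem : x - y ∈ C) (hnotMem : x - y ∉ D)
    (hunion : (suppSub D ∪ supp x).card ≤ (suppSub D ∪ supp a).card)
    (hx : (supp x).card ≤ (supp a).card) (hy : (supp y).card ≤ (supp b).card) :
    IsBalancedPair C D m x y := by
  have h₁ := card_suppSub_union_supp_sub_le D x y
  have h₂ := hm.card_union_le _ hmem hnotMem
  have h₃ := hab.card_union
  have h₄ := hm.card_le _ hmem hnotMem (by omega)
  have h₅ := card_supp_sub_le x y
  have h₆ := hab.card_add
  have h₇ := hab.le
  have h₈ := hab.le_succ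
  exact ⟨hmem, hnotMem, by omega, by omega, by omega, by omega⟩

lemma card_supp_single_add_le {y : Fin n → F} {i : Fin n} (hi : i ∈ supp a)
    (h : (supp y).card ≤ (supp (erase a i)).card) :
    (supp (Pi.single i (a i) + y)).card ≤ (supp a).card := by
  have hadd := (Finset.card_le_card (supp_add_subset (Pi.single i (a i)) y)).trans
    (Finset.card_union_le _ _)
  rw [supp_single (mem_supp.mp hi), Finset.card_singleton] at hadd
  have := card_supp_erase hi
  omega

variable [Finite F] {ord : MonomialOrder (Fin n × Fˣ)}

/-- A balanced pair for which the product of the two monomials is as small as possible. -/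
structure IsLeastBalancedPair (ord : MonomialOrder (Fin n × Fˣ)) (C D : Submodule F (Fin n → F))
    (m a b : Fin n → F) : Prop extends IsBalancedPair C D m a b where
  not_lt : ∀ x y, IsBalancedPair C D m x y → ¬ expo x + expo y ≺[ord] expo a + expo b

lemma IsBalancedPair.exists_isLeastBalancedPair (hab : IsBalancedPair C D m a b) :
    ∃ a b, IsLeastBalancedPair ord C D m a b := by
  obtain ⟨⟨x, y⟩, hxy, hleast⟩ :=
    (InvImage.wf (fun p : (Fin n → F) × (Fin n → F) => ord.toSyn (expo p.1 + expo p.2))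
      wellFounded_lt).has_min {p | IsBalancedPair C D m p.1 p.2} ⟨(a, b), hab⟩
  exact ⟨x, y, hxy, fun x' y' h => hleast (x', y') h⟩

namespace IsLeastBalancedPair

lemma left_le (h : IsLeastBalancedPair ord C D m a b) {x : Fin n → F}
    (hx : IsBalancedPair C D m x b) : expo a ≼[ord] expo x := by
  simpa using h.not_lt x b hx

lemma right_le (h : IsLeastBalancedPair ord C D m a b) {y : Fin n → F}
    (hy : IsBalancedPair C D m a y) : expo b ≼[ord] expo y := by
  simpa using h.not_lt a y hy

variable (hdeg : DegreeCompatible ord) (hm : IsRelativelyMinimal C D m)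
  (h : IsLeastBalancedPair ord C D m a b)
include hdeg hm h

lemma isCosetLeader_erase_left {i : Fin n} (hi : i ∈ supp a) :
    IsCosetLeader ord C (erase a i) := by
  intro x hx
  by_contra! hlt
  have hxcard := card_supp_le_of_expo_le hdeg hlt.le
  by_cases hxD : erase a i - x ∈ D
  · have hsplit : Pi.single i (a i) + x - b = (a - b) - (erase a i - x) := by
      linear_combination single_add_erase a i
    have hunion : suppSub D ∪ supp (Pi.single i (a i) + x) = suppSub D ∪ supp a := by
      refine (suppSub_union_supp_congr ?_).symm
      have : a - (Pi.single i (a i) + x) = erase a i - x := by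
        linear_combination -single_add_erase a i
      rwa [this]
    refine (h.left_le (.of_card_le hm h.toIsBalancedPair ?_ ?_ (by rw [hunion])
      (card_supp_single_add_le hi hxcard) le_rfl)).not_gt (expo_single_add_lt hdeg hlt)
    · exact hsplit ▸ C.sub_mem h.mem hx
    · rw [hsplit]
      exact fun hD => h.notMem ((D.sub_mem_iff_left hxD).mp hD)
  · have h₁ := card_suppSub_union_supp_sub_le D (erase a i) x
    have h₂ := Finset.card_le_card (Finset.union_subset_union_right (s := suppSub D)
      ((supp_erase a i).trans_subset (Finset.erase_subset _ _)))
    have h₃ := card_supp_sub_le (erase a i) x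
    have h₄ := card_supp_erase hi
    have h₅ := h.card_union
    have h₆ := h.card_add
    have h₇ := h.le_succ
    have := hm.card_le _ hx hxD (by omega)
    omega

lemma sub_leader_of_right_lt (hlt : expo b ≺[ord] expo a) {x : Fin n → F} (hx : a - x ∈ C)
    (hleader : IsCosetLeader ord C x) : IsRelativelyMinimal C D (a - x) := by
  have hxb : expo x ≼[ord] expo b := hleader b (by simpa using C.sub_mem h.mem hx)
  have hxcard := card_supp_le_of_expo_le hdeg hxb
  have hacard := card_supp_le_of_expo_le hdeg hlt.le
  by_cases hxD : a - x ∈ D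
  · have hsplit : x - b = (a - b) - (a - x) := by abel
    refine ((h.left_le (.of_card_le hm h.toIsBalancedPair ?_ ?_
      (by rw [suppSub_union_supp_congr hxD]) (by omega) le_rfl)).not_gt
      (hxb.trans_lt hlt)).elim
    · exact hsplit ▸ C.sub_mem h.mem hx
    · rw [hsplit]
      exact fun hD => h.notMem ((D.sub_mem_iff_left hxD).mp hD)
  · have h₁ := card_suppSub_union_supp_sub_le D a x
    have h₂ := card_supp_sub_le a x
    have h₃ := h.card_union
    have h₄ := h.card_add
    exact hm.of_card_le hx hxD (by omega) (by omega)

lemma isCosetLeader_erase_right {i : Fin n} (hi : i ∈ supp b) :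
    IsCosetLeader ord C (erase b i) := by
  intro y hy
  by_contra! hlt
  have hycard := card_supp_le_of_expo_le hdeg hlt.le
  have hsplit : a - (Pi.single i (b i) + y) = (a - b) + (erase b i - y) := by
    linear_combination -single_add_erase b i
  by_cases hD : a - (Pi.single i (b i) + y) ∈ D
  · have hyD : erase b i - y ∉ D := fun hyD => h.notMem ((D.add_mem_iff_left hyD).mp (hsplit ▸ hD))
    have hunion : suppSub D ∪ supp (erase b i - y) = suppSub D ∪ supp (a - b) := by
      rw [← supp_neg (a - b)]
      refine suppSub_union_supp_congr ?_
      rwa [sub_neg_eq_add, add_comm, ← hsplit]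
    have h₁ := card_suppSub_union_supp_sub_le D a b
    have h₂ := card_supp_sub_le (erase b i) y
    have h₃ := card_supp_erase hi
    have h₄ := h.card_union
    have h₅ := h.card_add
    have h₆ := h.le
    have := hm.card_le _ hy hyD (by rw [hunion]; omega)
    omega
  · exact (h.right_le (.of_card_le hm h.toIsBalancedPair (hsplit ▸ C.add_mem h.mem hy) hD le_rfl
      le_rfl (card_supp_single_add_le hi hycard))).not_gt (expo_single_add_lt hdeg hlt)

lemma sub_leader_of_left_lt (hlt : expo a ≺[ord] expo b) {y : Fin n → F} (hy : b - y ∈ C)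
    (hleader : IsCosetLeader ord C y) : IsRelativelyMinimal C D (b - y) := by
  have hya : expo y ≼[ord] expo a := hleader a (by
    simpa using C.sub_mem (C.neg_mem h.mem) hy)
  have hycard := card_supp_le_of_expo_le hdeg hya
  have hbcard := card_supp_le_of_expo_le hdeg hlt.le
  have hsplit : a - y = (a - b) + (b - y) := by abel
  by_cases hD : a - y ∈ D
  · have hyD : b - y ∉ D := fun hyD => h.notMem ((D.add_mem_iff_left hyD).mp (hsplit ▸ hD))
    have hunion : suppSub D ∪ supp (b - y) = suppSub D ∪ supp (a - b) := by
      rw [← supp_neg (a - b)]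
      refine suppSub_union_supp_congr ?_
      rwa [sub_neg_eq_add, add_comm, ← hsplit]
    have h₁ := card_suppSub_union_supp_sub_le D a b
    have h₂ := card_supp_sub_le b y
    have h₃ := h.card_union
    have h₄ := h.card_add
    exact hm.of_card_le hy hyD (by rw [hunion]; omega) (by omega)
  · exact ((h.right_le (.of_card_le hm h.toIsBalancedPair (hsplit ▸ C.add_mem h.mem hy) hD le_rfl
      le_rfl (by omega))).not_gt (hya.trans_lt hlt)).elim

end IsLeastBalancedPair

lemma IsRelativelyMinimal.exists_mem_groebnerWords (hm : IsRelativelyMinimal C D m)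
    (hinter : 2 * (suppSub D ∩ supp m).card ≤ (supp m).card + 1) (hdeg : DegreeCompatible ord)
    {K : Type*} [Field K] {G : Set (MvPolynomial (Fin n × Fˣ) K)}
    (hG : IsReducedGroebnerBasis ord (codeIdeal K C) G) :
    ∃ c ∈ groebnerWords ord C G, IsRelativelyMinimal C D c := by
  obtain ⟨x, y, hxy⟩ := hm.exists_isBalancedPair hinter
  obtain ⟨a, b, h⟩ := hxy.exists_isLeastBalancedPair (ord := ord)
  have hne : a ≠ b := fun hab => h.notMem (by simp [hab])
  rcases expo_lt_or_gt (ord := ord) hne with hlt | hlt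
  · obtain ⟨y, hy, hleader⟩ := exists_isCosetLeader ord C b
    have hmin := h.sub_leader_of_left_lt hdeg hm hlt hy hleader
    have hb : IsMinimalNonleader ord C b :=
      ⟨fun hb => (hb a (by simpa using C.neg_mem h.mem)).not_gt hlt,
        fun i hi => h.isCosetLeader_erase_right hdeg hm hi⟩
    exact ⟨b - y, hb.sub_mem_groebnerWords hdeg hG hleader hmin.mem_minSupportWords, hmin⟩
  · obtain ⟨x, hx, hleader⟩ := exists_isCosetLeader ord C a
    have hmin := h.sub_leader_of_right_lt hdeg hm hlt hx hleader
    have ha : IsMinimalNonleader ord C a :=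
      ⟨fun ha => (ha b h.mem).not_gt hlt, fun i hi => h.isCosetLeader_erase_left hdeg hm hi⟩
    exact ⟨a - x, ha.sub_mem_groebnerWords hdeg hG hleader hmin.mem_minSupportWords, hmin⟩

end RelativelyMinimal

/-! ### Gröbner words realizing the first two generalized Hamming weights -/

section FirstTwoWeights

variable {F : Type*} [Field F] [Finite F] {n : ℕ} {ord : MonomialOrder (Fin n × Fˣ)}
  {C : Submodule F (Fin n → F)} {m m₁ m₂ a b : Fin n → F}

/-- A splitting of `m`, up to sign, into disjoint halves `a` and `b` of almost equal weight, the
one with the larger monomial coming first. -/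
structure IsOrderedSplit (ord : MonomialOrder (Fin n × Fˣ)) (m a b : Fin n → F) : Prop where
  sub_eq : a - b = m ∨ b - a = m
  disjoint : Disjoint (supp a) (supp b)
  union_eq : supp a ∪ supp b = supp m
  lt : expo b ≺[ord] expo a
  le_succ : (supp a).card ≤ (supp b).card + 1

lemma exists_isOrderedSplit (hdeg : DegreeCompatible ord) (hm0 : m ≠ 0) :
    ∃ a b, IsOrderedSplit ord m a b := by
  obtain ⟨a, b, rfl, hdisj, hunion, -, hba, hab⟩ :=
    exists_balanced_split m (Finset.empty_subset _) (by simp)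
  rcases expo_lt_or_gt (ord := ord) (sub_ne_zero.mp hm0) with hlt | hlt
  · have := card_supp_le_of_expo_le hdeg hlt.le
    exact ⟨b, a, Or.inr rfl, hdisj.symm, by rw [Finset.union_comm, hunion], hlt, by omega⟩
  · exact ⟨a, b, Or.inl rfl, hdisj, hunion, hlt, hab⟩

namespace IsOrderedSplit

lemma card_add (h : IsOrderedSplit ord m a b) :
    (supp a).card + (supp b).card = (supp m).card := by
  rw [← h.union_eq, Finset.card_union_of_disjoint h.disjoint]

lemma left_subset (h : IsOrderedSplit ord m a b) : supp a ⊆ supp m :=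
  h.union_eq ▸ Finset.subset_union_left

lemma sub_mem (h : IsOrderedSplit ord m a b) {V : Submodule F (Fin n → F)} (hm : m ∈ V) :
    a - b ∈ V := by
  rcases h.sub_eq with rfl | rfl
  · exact hm
  · simpa using V.neg_mem hm

end IsOrderedSplit

lemma expo_sub_of_disjoint (h : Disjoint (supp a) (supp b)) :
    expo (a - b) = expo a + expo (-b) := by
  rw [sub_eq_add_neg, expo_add_of_disjoint (by simpa using h)]

namespace IsLeastWord

lemma expo_le_of_card_union_le (h : IsLeastWord ord (firstWords C) m) {x : Fin n → F} (hx : x ∈ C)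
    (hspan : x ∉ Submodule.span F {m}) (hcard : (supp m ∪ supp x).card ≤ ghw C 2) :
    expo m ≼[ord] expo x := by
  refine h.2 x ⟨hx, fun h0 => hspan (h0 ▸ Submodule.zero_mem _), m, h.1.1, ?_⟩
  rw [suppSub_span_pair, Finset.union_comm]
  exact (ghw_two_le h.1.1 hx h.1.2.1 hspan).antisymm hcard

lemma card_supp_lt_ghw_two (h : IsLeastWord ord (firstWords C) m) (hdeg : DegreeCompatible ord)
    (hC : 2 ≤ Module.finrank F C) : (supp m).card < ghw C 2 := by
  obtain ⟨x, hx, y, hy, hx0, hyx, hxy⟩ := exists_card_supp_union_eq_ghw_two hC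
  obtain ⟨t, ht⟩ := exists_smul_sub_ssubset_union hx0 y
  have htx : t • x ∈ Submodule.span F {x} :=
    Submodule.smul_mem _ t (Submodule.mem_span_singleton_self x)
  have hz0 : y - t • x ≠ 0 := fun h0 => hyx (sub_eq_zero.mp h0 ▸ htx)
  have hunion : supp (y - t • x) ∪ supp x = supp x ∪ supp y := by
    have := suppSub_union_supp_congr (D := Submodule.span F {x}) (x := y - t • x) (y := y)
      (by simpa using htx)
    rwa [suppSub_span_singleton, Finset.union_comm] at this
  have hfirst : y - t • x ∈ firstWords C :=
    ⟨C.sub_mem hy (C.smul_mem t hx), hz0, x, hx, by rw [suppSub_span_pair, hunion, hxy]⟩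
  exact (card_supp_le_of_expo_le hdeg (h.2 _ hfirst)).trans_lt (hxy ▸ Finset.card_lt_card ht)

lemma isCosetLeader_erase (h : IsLeastWord ord (firstWords C) m) (hdeg : DegreeCompatible ord)
    (hw : (supp m).card + (supp m).card / 2 ≤ ghw C 2) (hab : IsOrderedSplit ord m a b) {i : Fin n}
    (hi : i ∈ supp a) : IsCosetLeader ord C (erase a i) := by
  intro x hx
  by_contra! hlt
  have h₁ := card_supp_le_of_expo_le hdeg hlt.le
  have h₂ := card_supp_erase hi
  have h₃ := card_supp_sub_le (erase a i) x
  have h₄ := hab.card_add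
  have h₅ := hab.le_succ
  suffices (supp m).card ≤ (supp (erase a i - x)).card by omega
  by_cases hspan : erase a i - x ∈ Submodule.span F {m}
  · have h0 : erase a i - x ≠ 0 := fun h0 => hlt.ne (by rw [sub_eq_zero.mp h0])
    rw [supp_eq_of_mem_span_singleton hspan h0]
  · refine card_supp_le_of_expo_le hdeg (h.expo_le_of_card_union_le hx hspan ?_)
    have h₆ := card_suppSub_union_supp_sub_le (Submodule.span F {m}) (erase a i) x
    rw [suppSub_span_singleton, Finset.union_eq_left.mpr (((supp_erase a i).trans_subset
      (Finset.erase_subset _ _)).trans hab.left_subset)] at h₆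
    omega

lemma disjoint_supp_leader (h : IsLeastWord ord (firstWords C) m) (hdeg : DegreeCompatible ord)
    (hw : (supp m).card + (supp m).card / 2 ≤ ghw C 2) (hab : IsOrderedSplit ord m a b)
    {x : Fin n → F} (hx : a - x ∈ C) (hspan : a - x ∉ Submodule.span F {m})
    (hxb : expo x ≼[ord] expo b) :
    Disjoint (supp m) (supp x) ∧ (supp m ∪ supp (a - x)).card ≤ ghw C 2 := by
  have h₁ := ghw_two_le h.1.1 hx h.1.2.1 hspan
  have h₂ := Finset.card_le_card (Finset.union_subset_union_right (s := supp m)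
    (supp_sub_subset a x))
  rw [← Finset.union_assoc, Finset.union_eq_left.mpr hab.left_subset] at h₂
  have h₃ := Finset.card_union_le (supp m) (supp x)
  have h₄ := card_supp_le_of_expo_le hdeg hxb
  have h₅ := card_supp_le_of_expo_le hdeg hab.lt.le
  have h₆ := hab.card_add
  exact ⟨Finset.card_union_eq_card_add_card.mp (by omega), by omega⟩

lemma sub_leader_mem_span (h : IsLeastWord ord (firstWords C) m) (hdeg : DegreeCompatible ord)
    (hneg : NegCompatible ord) (hw : (supp m).card + (supp m).card / 2 ≤ ghw C 2)
    (hab : IsOrderedSplit ord m a b) {x : Fin n → F} (hx : a - x ∈ C)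
    (hleader : IsCosetLeader ord C x) : a - x ∈ Submodule.span F {m} := by
  by_contra hspan
  have hle : expo x ≼[ord] expo b := hleader b (by simpa using C.sub_mem (hab.sub_mem h.1.1) hx)
  have hne : x ≠ b := fun hxb =>
    hspan (hxb ▸ hab.sub_mem (Submodule.mem_span_singleton_self m))
  have hlt := (expo_lt_or_gt (ord := ord) hne).resolve_right hle.not_gt
  obtain ⟨hdisj, hcard⟩ := h.disjoint_supp_leader hdeg hw hab hx hspan hle
  have hdisj_a : Disjoint (supp a) (supp x) := hdisj.mono_left hab.left_subset
  -- Replacing `b` by `x` in `m = ±(a - b)` yields a smaller candidate for the first word.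
  rcases hab.sub_eq with hm | hm
  · have hdisj_b : Disjoint (supp b) (supp x) :=
      hdisj.mono_left (hab.union_eq ▸ Finset.subset_union_right)
    have hmle := h.expo_le_of_card_union_le hx hspan hcard
    rw [← hm, expo_sub_of_disjoint hab.disjoint, expo_sub_of_disjoint hdisj_a, map_add,
      map_add] at hmle
    exact hmle.not_gt (add_lt_add_right (hneg b x hdisj_b hlt) _)
  · have hsub : x - a = -(a - x) := (neg_sub a x).symm
    have hmle := h.expo_le_of_card_union_le (x := x - a) (hsub ▸ C.neg_mem hx)
      (by rwa [hsub, Submodule.neg_mem_iff]) (by rwa [hsub, supp_neg])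
    rw [← hm, expo_sub_of_disjoint hab.disjoint.symm, expo_sub_of_disjoint hdisj_a.symm, map_add,
      map_add] at hmle
    exact hmle.not_gt (add_lt_add_left hlt _)

lemma isRelativelyMinimal (h₁ : IsLeastWord ord (firstWords C) m₁)
    (h₂ : IsLeastWord ord (secondWords C m₁) m₂) (hdeg : DegreeCompatible ord)
    (hC : 2 ≤ Module.finrank F C) : IsRelativelyMinimal C (Submodule.span F {m₁}) m₂ := by
  have hcard : (supp m₁ ∪ supp m₂).card = ghw C 2 := by rw [← suppSub_span_pair, ← h₂.1.2]
  refine ⟨h₂.1.1, fun hspan => ?_, fun x hx hspan => ?_, fun x hx hspan hle => ?_⟩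
  · rw [← suppSub_span_singleton m₁, Finset.union_eq_left.mpr (supp_subset_suppSub hspan),
      suppSub_span_singleton] at hcard
    exact (h₁.card_supp_lt_ghw_two hdeg hC).ne hcard
  · rw [suppSub_span_singleton, hcard]
    exact ghw_two_le h₁.1.1 hx h₁.1.2.1 hspan
  · rw [suppSub_span_singleton, hcard] at hle
    refine card_supp_le_of_expo_le hdeg (h₂.2 x ⟨hx, ?_⟩)
    rw [suppSub_span_pair]
    exact (ghw_two_le h₁.1.1 hx h₁.1.2.1 hspan).antisymm hle

end IsLeastWord

variable {K : Type*} [Field K] {G : Set (MvPolynomial (Fin n × Fˣ) K)}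

lemma IsLeastWord.exists_mem_groebnerWords (h : IsLeastWord ord (firstWords C) m)
    (hC : 2 ≤ Module.finrank F C) (hdeg : DegreeCompatible ord) (hneg : NegCompatible ord)
    (hG : IsReducedGroebnerBasis ord (codeIdeal K C) G)
    (hw : (supp m).card + (supp m).card / 2 ≤ ghw C 2) :
    ∃ c ∈ groebnerWords ord C G, supp c = supp m := by
  obtain ⟨a, b, hab⟩ := exists_isOrderedSplit hdeg h.1.2.1
  obtain ⟨x, hx, hleader⟩ := exists_isCosetLeader ord C a
  have ha : IsMinimalNonleader ord C a :=
    ⟨fun ha => (ha b (hab.sub_mem h.1.1)).not_gt hab.lt,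
      fun i hi => h.isCosetLeader_erase hdeg hw hab hi⟩
  have h0 : a - x ≠ 0 := fun h0 => ha.not_isCosetLeader (sub_eq_zero.mp h0 ▸ hleader)
  have hsupp := supp_eq_of_mem_span_singleton
    (h.sub_leader_mem_span hdeg hneg hw hab hx hleader) h0
  refine ⟨a - x, ha.sub_mem_groebnerWords hdeg hG hleader ?_, hsupp⟩
  exact mem_minSupportWords_of_card_lt_ghw_two hx h0 (hsupp ▸ h.card_supp_lt_ghw_two hdeg hC)

theorem isLeast_card_supp_groebnerWords (hC : 1 ≤ Module.finrank F C)
    (hdeg : DegreeCompatible ord) (hG : IsReducedGroebnerBasis ord (codeIdeal K C) G) :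
    IsLeast (Finset.card '' (supp '' groebnerWords ord C G)) (ghw C 1) := by
  obtain ⟨m, hm, hm0, hcard⟩ := exists_card_supp_eq_ghw_one hC
  have hmin : IsRelativelyMinimal C ⊥ m := by
    refine ⟨hm, by simpa using hm0, fun x hx hx0 => ?_, fun x hx hx0 _ => ?_⟩
    · simpa [hcard] using ghw_one_le hx (by simpa using hx0)
    · simpa [hcard] using ghw_one_le hx (by simpa using hx0)
  obtain ⟨c, hc, hcmin⟩ := hmin.exists_mem_groebnerWords (by simp) hdeg hG
  refine ⟨⟨_, ⟨c, hc, rfl⟩, by simpa [hcard] using hmin.card_union_eq hcmin⟩, ?_⟩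
  rintro _ ⟨_, ⟨c, hc, rfl⟩, rfl⟩
  exact ghw_one_le hc.1.1 hc.2.2.1

theorem isLeast_card_union_supp_groebnerWords (hC : 2 ≤ Module.finrank F C)
    (hdeg : DegreeCompatible ord) (hneg : NegCompatible ord)
    (hG : IsReducedGroebnerBasis ord (codeIdeal K C) G)
    (h₁ : IsLeastWord ord (firstWords C) m₁) (h₂ : IsLeastWord ord (secondWords C m₁) m₂)
    (hinter : 2 * (supp m₁ ∩ supp m₂).card ≤ (supp m₂).card + 1) :
    IsLeast {d | ∃ S ∈ supp '' groebnerWords ord C G, ∃ T ∈ supp '' groebnerWords ord C G,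
      S ≠ T ∧ (S ∪ T).card = d} (ghw C 2) := by
  have hcard : (supp m₁ ∪ supp m₂).card = ghw C 2 := by rw [← suppSub_span_pair, ← h₂.1.2]
  have hmin := h₁.isRelativelyMinimal h₂ hdeg hC
  have hle := card_supp_le_of_expo_le hdeg
    (h₁.expo_le_of_card_union_le hmin.mem hmin.notMem hcard.le)
  have hadd := Finset.card_union_add_card_inter (supp m₁) (supp m₂)
  obtain ⟨c₁, hc₁, hsupp⟩ := h₁.exists_mem_groebnerWords hC hdeg hneg hG (by omega)
  obtain ⟨c₂, hc₂, hc₂min⟩ := hmin.exists_mem_groebnerWords (by rwa [suppSub_span_singleton]) hdeg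
    hG
  have hunion : (supp c₁ ∪ supp c₂).card = ghw C 2 := by
    rw [hsupp, ← hcard, ← suppSub_span_singleton m₁]
    exact hmin.card_union_eq hc₂min
  refine ⟨⟨_, ⟨c₁, hc₁, rfl⟩, _, ⟨c₂, hc₂, rfl⟩, fun heq => ?_, hunion⟩, ?_⟩
  · rw [← heq, Finset.union_self, hsupp] at hunion
    exact (h₁.card_supp_lt_ghw_two hdeg hC).ne hunion
  · rintro _ ⟨_, ⟨c, hc, rfl⟩, _, ⟨c', hc', rfl⟩, hne, rfl⟩
    exact ghw_two_le hc.1.1 hc'.1.1 hc.2.2.1 fun hspan =>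
      hne (supp_eq_of_mem_span_singleton hspan hc'.2.2.1).symm

end FirstTwoWeights

/-! ### Graded free modules over a polynomial ring -/

section GradedFreeModule

open MvPolynomial

variable {σ ι κ ν R : Type*} [CommSemiring R]

/-- `v` is a homogeneous element of degree `j` of the graded free module `⨁ₗ R[σ](-deg l)`; the
zero vector is homogeneous of every degree. -/
def IsHomogVec (deg : ι → ℕ) (j : ℕ) (v : ι → MvPolynomial σ R) : Prop :=
  ∀ l, ∀ s ∈ (v l).support, s.degree + deg l = j

/-- The degrees of the nonzero homogeneous elements of the submodule `N` of `⨁ₗ R[σ](-deg l)`. -/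
def nonzeroDegrees (deg : ι → ℕ) (N : Submodule (MvPolynomial σ R) (ι → MvPolynomial σ R)) :
    Set ℕ :=
  {j | ∃ v ∈ N, v ≠ 0 ∧ IsHomogVec deg j v}

variable (σ ι R) in
/-- The submodule `𝔪 F` of the free module `F = R[σ]^ι`, where `𝔪` is the ideal generated by the
indeterminates. -/
def irrelevantSub : Submodule (MvPolynomial σ R) (ι → MvPolynomial σ R) :=
  Submodule.pi Set.univ fun _ => RingHom.ker (constantCoeff (σ := σ) (R := R))

lemma mem_irrelevantSub {v : ι → MvPolynomial σ R} :
    v ∈ irrelevantSub σ ι R ↔ ∀ l, constantCoeff (v l) = 0 := by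
  simp [irrelevantSub, Submodule.mem_pi, RingHom.mem_ker]

lemma IsHomogVec.coeff_eq_zero {deg : ι → ℕ} {j : ℕ} {v : ι → MvPolynomial σ R}
    (hv : IsHomogVec deg j v) {l : ι} {s : σ →₀ ℕ} (h : s.degree + deg l ≠ j) :
    coeff s (v l) = 0 :=
  notMem_support_iff.mp fun hs => h (hv l s hs)

lemma IsHomogVec.eq_zero_of_lt {deg : ι → ℕ} {j : ℕ} {v : ι → MvPolynomial σ R}
    (hv : IsHomogVec deg j v) {l : ι} (h : j < deg l) : v l = 0 :=
  MvPolynomial.ext _ _ fun s => by rw [hv.coeff_eq_zero (by omega), coeff_zero]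

lemma IsHomogVec.eq_C_of_eq {deg : ι → ℕ} {j : ℕ} {v : ι → MvPolynomial σ R}
    (hv : IsHomogVec deg j v) {l : ι} (h : deg l = j) : v l = C (constantCoeff (v l)) := by
  classical
  ext s
  rw [coeff_C]
  split_ifs with hs
  · rw [← hs, constantCoeff_eq]
  · refine hv.coeff_eq_zero fun hs' => hs ?_
    rw [eq_comm, ← Finsupp.degree_eq_zero_iff]
    omega

lemma IsHomogVec.sub {R : Type*} [CommRing R] {deg : ι → ℕ} {j : ℕ} {v w : ι → MvPolynomial σ R}
    (hv : IsHomogVec deg j v) (hw : IsHomogVec deg j w) : IsHomogVec deg j (v - w) := by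
  intro l s hs
  by_contra h
  rw [mem_support_iff, Pi.sub_apply, coeff_sub, hv.coeff_eq_zero h, hw.coeff_eq_zero h,
    sub_zero] at hs
  exact hs rfl

lemma isHomogVec_single_monomial [DecidableEq ι] (deg : ι → ℕ) (k : ι) (t : σ →₀ ℕ) (r : R) :
    IsHomogVec deg (t.degree + deg k) (Pi.single k (monomial t r)) := by
  intro l s hs
  obtain rfl | hl := eq_or_ne l k
  · rw [Pi.single_eq_same] at hs
    rw [Finset.mem_singleton.mp (support_monomial_subset hs)]
  · simp [hl] at hs

lemma IsHomogVec.sum_smul [Fintype κ] {deg : ι → ℕ} {deg' : κ → ℕ} {j : ℕ}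
    {v : κ → MvPolynomial σ R} (hv : IsHomogVec deg' j v) {w : κ → ι → MvPolynomial σ R}
    (hw : ∀ k, IsHomogVec deg (deg' k) (w k)) : IsHomogVec deg j (∑ k, v k • w k) := by
  classical
  intro l s hs
  rw [mem_support_iff, Finset.sum_apply, coeff_sum] at hs
  obtain ⟨k, -, hk⟩ := Finset.exists_ne_zero_of_sum_ne_zero hs
  obtain ⟨a, ha, b, hb, rfl⟩ := Finset.mem_add.mp (support_mul _ _ (mem_support_iff.mpr hk))
  have hva := hv k a ha
  have hwb := hw k l b hb
  rw [map_add]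
  omega

/-- The homogeneous component of degree `j` of an element of `⨁ₗ R[σ](-deg l)`. -/
def homogComp (deg : ι → ℕ) (j : ℕ) : (ι → MvPolynomial σ R) →ₗ[R] (ι → MvPolynomial σ R) :=
  LinearMap.pi fun l => if deg l ≤ j then homogeneousComponent (j - deg l) ∘ₗ LinearMap.proj l
    else 0

lemma coeff_homogComp (deg : ι → ℕ) (j : ℕ) (v : ι → MvPolynomial σ R) (l : ι) (s : σ →₀ ℕ) :
    coeff s (homogComp deg j v l) = if s.degree + deg l = j then coeff s (v l) else 0 := by
  rw [homogComp, LinearMap.pi_apply]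
  by_cases h : deg l ≤ j
  · have hiff : s.degree = j - deg l ↔ s.degree + deg l = j := by omega
    rw [if_pos h, LinearMap.comp_apply, LinearMap.proj_apply, coeff_homogeneousComponent]
    simp only [hiff]
  · rw [if_neg h, if_neg (by omega), LinearMap.zero_apply, coeff_zero]

lemma isHomogVec_homogComp (deg : ι → ℕ) (j : ℕ) (v : ι → MvPolynomial σ R) :
    IsHomogVec deg j (homogComp deg j v) := by
  intro l s hs
  rw [mem_support_iff, coeff_homogComp] at hs
  exact (ite_ne_right_iff.mp hs).1

lemma IsHomogVec.homogComp_eq {deg : ι → ℕ} {j : ℕ} {v : ι → MvPolynomial σ R}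
    (hv : IsHomogVec deg j v) : homogComp deg j v = v := by
  ext l s
  rw [coeff_homogComp]
  split_ifs with h
  · rfl
  · exact (hv.coeff_eq_zero h).symm

lemma IsHomogVec.homogComp_eq_zero {deg : ι → ℕ} {i j : ℕ} {v : ι → MvPolynomial σ R}
    (hv : IsHomogVec deg j v) (hij : i ≠ j) : homogComp deg i v = 0 := by
  ext l s
  rw [coeff_homogComp]
  split_ifs with h
  · exact hv.coeff_eq_zero (h.trans_ne hij)
  · rfl

lemma eventually_sum_homogComp_eq [Finite ι] (deg : ι → ℕ) (v : ι → MvPolynomial σ R) :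
    ∀ᶠ N in Filter.atTop, ∑ j ∈ Finset.range N, homogComp deg j v = v := by
  have hbound : ∀ᶠ N in Filter.atTop, ∀ l, (v l).totalDegree + deg l < N :=
    Filter.eventually_all.mpr fun l => Filter.eventually_gt_atTop _
  filter_upwards [hbound] with N hN
  ext l s
  simp only [Finset.sum_apply, coeff_sum, coeff_homogComp, Finset.sum_ite_eq, Finset.mem_range,
    ite_eq_left_iff, not_lt]
  intro hs
  refine (notMem_support_iff.mp fun hmem => ?_).symm
  have hle : s.degree ≤ (v l).totalDegree := le_totalDegree hmem
  exact absurd (hN l) (by omega)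

/-- The linear map `⨁ₖ R[σ](-deg' k) → ⨁ₗ R[σ](-deg l)` is homogeneous of degree zero. -/
def IsHomogMap [DecidableEq κ] (deg' : κ → ℕ) (deg : ι → ℕ)
    (φ : (κ → MvPolynomial σ R) →ₗ[MvPolynomial σ R] (ι → MvPolynomial σ R)) : Prop :=
  ∀ k, IsHomogVec deg (deg' k) (φ (Pi.single k 1))

lemma map_eq_sum_smul [Fintype κ] [DecidableEq κ] {A M : Type*} [Semiring A] [AddCommMonoid M]
    [Module A M] (φ : (κ → A) →ₗ[A] M) (v : κ → A) : φ v = ∑ k, v k • φ (Pi.single k 1) := by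
  conv_lhs => rw [← Finset.univ_sum_single v, map_sum]
  refine Finset.sum_congr rfl fun k _ => ?_
  rw [← map_smul, ← Pi.single_smul, smul_eq_mul, mul_one]

section HomogMap

variable [DecidableEq κ] {deg' : κ → ℕ} {deg : ι → ℕ}

lemma isHomogMap_linearCombination [Fintype κ] {g : κ → ι → MvPolynomial σ R}
    (hg : ∀ k, IsHomogVec deg (deg' k) (g k)) :
    IsHomogMap deg' deg (Fintype.linearCombination (MvPolynomial σ R) g) := by
  intro k
  rw [Fintype.linearCombination_apply_single, one_smul]
  exact hg k

variable [Finite κ] {φ : (κ → MvPolynomial σ R) →ₗ[MvPolynomial σ R] (ι → MvPolynomial σ R)}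

lemma IsHomogMap.isHomogVec (hφ : IsHomogMap deg' deg φ) {j : ℕ} {v : κ → MvPolynomial σ R}
    (hv : IsHomogVec deg' j v) : IsHomogVec deg j (φ v) := by
  cases nonempty_fintype κ
  rw [map_eq_sum_smul]
  exact hv.sum_smul hφ

lemma IsHomogMap.map_homogComp (hφ : IsHomogMap deg' deg φ) (j : ℕ) (v : κ → MvPolynomial σ R) :
    φ (homogComp deg' j v) = homogComp deg j (φ v) := by
  have himage (i) : IsHomogVec deg i (φ (homogComp deg' i v)) :=
    hφ.isHomogVec (isHomogVec_homogComp _ _ _)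
  obtain ⟨N, hN, hjN⟩ :=
    ((eventually_sum_homogComp_eq deg' v).and (Filter.eventually_gt_atTop j)).exists
  calc φ (homogComp deg' j v)
      = ∑ i ∈ Finset.range N, homogComp deg j (φ (homogComp deg' i v)) := by
        rw [Finset.sum_eq_single_of_mem j (Finset.mem_range.mpr hjN)
          fun i _ hij => (himage i).homogComp_eq_zero hij.symm, (himage j).homogComp_eq]
    _ = homogComp deg j (φ v) := by rw [← map_sum, ← map_sum, hN]

lemma IsHomogMap.comp [DecidableEq ν] {deg'' : ν → ℕ} (hφ : IsHomogMap deg' deg φ)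
    {ψ : (ν → MvPolynomial σ R) →ₗ[MvPolynomial σ R] (κ → MvPolynomial σ R)}
    (hψ : IsHomogMap deg'' deg' ψ) : IsHomogMap deg'' deg (φ ∘ₗ ψ) :=
  fun k => hφ.isHomogVec (hψ k)

lemma IsHomogMap.exists_deg_le (hφ : IsHomogMap deg' deg φ) {j : ℕ}
    (hj : j ∈ nonzeroDegrees deg (LinearMap.range φ)) : ∃ k, deg' k ≤ j := by
  obtain ⟨_, ⟨z, rfl⟩, hz0, hz⟩ := hj
  by_contra! h
  have hcomp : homogComp deg' j z = 0 :=
    funext fun k => (isHomogVec_homogComp _ _ z).eq_zero_of_lt (h k)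
  rw [← hz.homogComp_eq, ← hφ.map_homogComp, hcomp, map_zero] at hz0
  exact hz0 rfl

lemma IsHomogMap.exists_lift [Finite ν] [DecidableEq ν] {deg'' : ν → ℕ}
    (hφ : IsHomogMap deg' deg φ)
    {ψ : (ν → MvPolynomial σ R) →ₗ[MvPolynomial σ R] (ι → MvPolynomial σ R)}
    (hψ : IsHomogMap deg'' deg ψ) (h : LinearMap.range ψ ≤ LinearMap.range φ) :
    ∃ τ : (ν → MvPolynomial σ R) →ₗ[MvPolynomial σ R] (κ → MvPolynomial σ R),
      IsHomogMap deg'' deg' τ ∧ φ ∘ₗ τ = ψ := by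
  cases nonempty_fintype ν
  choose t ht using fun k => h (LinearMap.mem_range_self ψ (Pi.single k 1))
  refine ⟨Fintype.linearCombination _ fun k => homogComp deg' (deg'' k) (t k),
    isHomogMap_linearCombination fun k => isHomogVec_homogComp _ _ _, LinearMap.pi_ext' fun k => ?_⟩
  ext1
  simp only [LinearMap.comp_apply, LinearMap.coe_single, Fintype.linearCombination_apply_single,
    one_smul]
  rw [hφ.map_homogComp, ht, (hψ k).homogComp_eq]

end HomogMap

section Comparison

variable {R : Type*} [CommRing R] [Finite κ] [DecidableEq κ] [Finite ν] [DecidableEq ν]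
  {deg' : κ → ℕ} {deg : ι → ℕ} {deg'' : ν → ℕ}

/-- Graded Nakayama: ordered by degree, the matrix of `θ` is triangular with identity diagonal
blocks. -/
lemma IsHomogMap.injective_of_sub_mem_irrelevantSub
    {θ : (κ → MvPolynomial σ R) →ₗ[MvPolynomial σ R] (κ → MvPolynomial σ R)}
    (hθ : IsHomogMap deg' deg' θ) (h : ∀ v, θ v - v ∈ irrelevantSub σ κ R) :
    Function.Injective θ := by
  cases nonempty_fintype κ
  rw [injective_iff_map_eq_zero]
  intro v hv
  by_contra hv0
  obtain ⟨k, hk, hmax⟩ := (Set.toFinite {k | v k ≠ 0}).exists_maximalFor deg' _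
    (Function.ne_iff.mp hv0)
  have hentry (i) (hi : v i ≠ 0) :
      θ (Pi.single i 1) k = (Pi.single i 1 : κ → MvPolynomial σ R) k := by
    obtain hlt | heq := (not_lt.mp fun hlt => hlt.not_ge (hmax hi hlt.le)).lt_or_eq
    · rw [(hθ i).eq_zero_of_lt hlt, Pi.single_eq_of_ne (by rintro rfl; exact hlt.false)]
    · have hconst := mem_irrelevantSub.mp (h (Pi.single i 1)) k
      rw [Pi.sub_apply, map_sub, sub_eq_zero] at hconst
      rw [(hθ i).eq_C_of_eq heq.symm, hconst]
      obtain rfl | hik := eq_or_ne k i <;> simp [*]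
  refine hk ?_
  calc v k = ∑ i, v i * (Pi.single i 1 : κ → MvPolynomial σ R) k := by
        simp [Pi.single_apply]
    _ = θ v k := by
        rw [map_eq_sum_smul, Finset.sum_apply]
        refine Finset.sum_congr rfl fun i _ => ?_
        by_cases hi : v i = 0
        · simp [hi]
        · rw [Pi.smul_apply, smul_eq_mul, hentry i hi]
    _ = 0 := congrFun hv k

/-- Lifting each presentation through the other makes `ker ψ` a graded submodule of `ker φ`. -/
lemma nonzeroDegrees_ker_subset
    {φ : (κ → MvPolynomial σ R) →ₗ[MvPolynomial σ R] (ι → MvPolynomial σ R)}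
    {ψ : (ν → MvPolynomial σ R) →ₗ[MvPolynomial σ R] (ι → MvPolynomial σ R)}
    (hφ : IsHomogMap deg' deg φ) (hψ : IsHomogMap deg'' deg ψ)
    (hrange : LinearMap.range ψ = LinearMap.range φ)
    (hmin : LinearMap.ker ψ ≤ irrelevantSub σ ν R) :
    nonzeroDegrees deg'' (LinearMap.ker ψ) ⊆ nonzeroDegrees deg' (LinearMap.ker φ) := by
  obtain ⟨τ, hτ, hφτ⟩ := hφ.exists_lift hψ hrange.le
  obtain ⟨υ, hυ, hψυ⟩ := hψ.exists_lift hφ hrange.ge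
  have hinj : Function.Injective (υ ∘ₗ τ) :=
    (hυ.comp hτ).injective_of_sub_mem_irrelevantSub fun v => hmin <| by
      rw [LinearMap.mem_ker, map_sub, ← LinearMap.comp_apply, ← LinearMap.comp_assoc, hψυ, hφτ,
        sub_self]
  rintro j ⟨v, hv, hv0, hvj⟩
  refine ⟨τ v, ?_, fun h => hv0 (hinj ?_), hτ.isHomogVec hvj⟩
  · rw [LinearMap.mem_ker, ← LinearMap.comp_apply, hφτ, hv]
  · rw [LinearMap.comp_apply, h, map_zero, map_zero]

end Comparison

end GradedFreeModule

/-! ### Minimal graded free resolutions -/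

section GradedSubmodule

open MvPolynomial

variable {σ ι κ : Type*}

/-- `N` is a graded submodule of `⨁ₗ R[σ](-deg l)`: it contains the homogeneous components of its
elements. -/
def IsGradedSub {R : Type*} [CommSemiring R] (deg : ι → ℕ)
    (N : Submodule (MvPolynomial σ R) (ι → MvPolynomial σ R)) : Prop :=
  ∀ v ∈ N, ∀ j, homogComp deg j v ∈ N

lemma IsHomogMap.isGradedSub_ker {R : Type*} [CommSemiring R] [Finite κ] [DecidableEq κ]
    {deg' : κ → ℕ} {deg : ι → ℕ}
    {φ : (κ → MvPolynomial σ R) →ₗ[MvPolynomial σ R] (ι → MvPolynomial σ R)}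
    (hφ : IsHomogMap deg' deg φ) : IsGradedSub deg' (LinearMap.ker φ) := by
  intro v hv j
  rw [LinearMap.mem_ker, hφ.map_homogComp, LinearMap.mem_ker.mp hv, map_zero]

lemma IsGradedSub.span_homogeneous {R : Type*} [CommSemiring R] [Finite ι] {deg : ι → ℕ}
    {N : Submodule (MvPolynomial σ R) (ι → MvPolynomial σ R)} (hN : IsGradedSub deg N) :
    Submodule.span (MvPolynomial σ R) {v | v ∈ N ∧ ∃ j, IsHomogVec deg j v} = N := by
  refine le_antisymm (Submodule.span_le.mpr fun v hv => hv.1) fun v hv => ?_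
  obtain ⟨m, hm⟩ := (eventually_sum_homogComp_eq deg v).exists
  rw [← hm]
  exact Submodule.sum_mem _ fun j _ =>
    Submodule.subset_span ⟨hN v hv j, j, isHomogVec_homogComp _ _ _⟩

lemma IsGradedSub.exists_minimal_generators {R : Type*} [CommRing R] [IsNoetherianRing R]
    [Finite σ] [Finite ι] {deg : ι → ℕ}
    {N : Submodule (MvPolynomial σ R) (ι → MvPolynomial σ R)} (hN : IsGradedSub deg N) :
    ∃ (r : ℕ) (deg' : Fin r → ℕ) (g : Fin r → ι → MvPolynomial σ R),
      (∀ k, IsHomogVec deg (deg' k) (g k)) ∧ Submodule.span _ (Set.range g) = N ∧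
      ∀ k, g k ∉ Submodule.span (MvPolynomial σ R) (g '' {k}ᶜ) := by
  classical
  have hfg : (Submodule.span (MvPolynomial σ R) {v | v ∈ N ∧ ∃ j, IsHomogVec deg j v}).FG :=
    IsNoetherian.noetherian _
  obtain ⟨S, hS, hSspan⟩ := (Submodule.fg_span_iff_fg_span_finset_subset _).mp hfg
  rw [hN.span_homogeneous] at hSspan
  obtain ⟨T, ⟨hT, hTspan⟩, hTmin⟩ := exists_minimal_of_wellFoundedLT
    (fun T : Finset (ι → MvPolynomial σ R) => (∀ v ∈ T, ∃ j, IsHomogVec deg j v) ∧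
      Submodule.span (MvPolynomial σ R) (T : Set (ι → MvPolynomial σ R)) = N)
    ⟨S, fun v hv => (hS hv).2, hSspan.symm⟩
  choose e he using fun v : T => hT v v.2
  let g : Fin T.card → ι → MvPolynomial σ R := fun k => T.equivFin.symm k
  have hrange : Set.range g = T := by
    change Set.range (Subtype.val ∘ T.equivFin.symm) = _
    rw [T.equivFin.symm.surjective.range_comp, Subtype.range_coe]
  have hginj : Function.Injective g := Subtype.val_injective.comp T.equivFin.symm.injective
  refine ⟨T.card, fun k => e (T.equivFin.symm k), g, fun k => he _, by rw [hrange, hTspan],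
    fun k hk => ?_⟩
  have hgk : g k ∈ T := (T.equivFin.symm k).2
  have hcompl : g '' {k}ᶜ = (T.erase (g k) : Finset (ι → MvPolynomial σ R)) := by
    rw [Set.image_compl_eq_range_sdiff_image hginj, hrange, Set.image_singleton, Finset.coe_erase]
  refine Finset.notMem_erase (g k) T (hTmin ⟨fun v hv => hT v (Finset.mem_of_mem_erase hv), ?_⟩
    (Finset.erase_subset _ _) hgk)
  rw [hcompl] at hk
  rw [← Submodule.span_insert_eq_span hk, ← Finset.coe_insert, Finset.insert_erase hgk, hTspan]

variable {K : Type*} [Field K]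

lemma ker_linearCombination_le_irrelevantSub [Fintype κ] {deg' : κ → ℕ}
    {deg : ι → ℕ} {g : κ → ι → MvPolynomial σ K} (hg : ∀ k, IsHomogVec deg (deg' k) (g k))
    (hmin : ∀ k, g k ∉ Submodule.span (MvPolynomial σ K) (g '' {k}ᶜ)) :
    LinearMap.ker (Fintype.linearCombination (MvPolynomial σ K) g) ≤ irrelevantSub σ κ K := by
  classical
  refine fun z hz => mem_irrelevantSub.mpr fun k => ?_
  by_contra hk
  set z' := homogComp deg' (deg' k) z
  have hz'k : z' k = C (constantCoeff (z k)) := by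
    rw [IsHomogVec.eq_C_of_eq (v := z') (isHomogVec_homogComp _ _ _) rfl, constantCoeff_eq,
      coeff_homogComp, map_zero, zero_add, if_pos rfl]
  have hrel : ∑ i, z' i • g i = 0 := by
    have hz'ker := (isHomogMap_linearCombination hg).isGradedSub_ker z hz (deg' k)
    rwa [LinearMap.mem_ker, Fintype.linearCombination_apply] at hz'ker
  refine hmin k ((Submodule.smul_mem_iff_of_isUnit _ (r := z' k) ?_).mp ?_)
  · exact hz'k ▸ (isUnit_iff_ne_zero.mpr hk).map C
  · rw [← Finset.add_sum_erase _ _ (Finset.mem_univ k)] at hrel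
    rw [eq_neg_of_add_eq_zero_left hrel]
    exact Submodule.neg_mem _ (Submodule.sum_mem _ fun i hi => Submodule.smul_mem _ _
      (Submodule.subset_span ⟨i, (Finset.mem_erase.mp hi).1, rfl⟩))

lemma IsGradedSub.exists_minimal_presentation [Finite σ] [Finite ι] {deg : ι → ℕ}
    {N : Submodule (MvPolynomial σ K) (ι → MvPolynomial σ K)} (hN : IsGradedSub deg N) :
    ∃ (r : ℕ) (deg' : Fin r → ℕ)
      (φ : (Fin r → MvPolynomial σ K) →ₗ[MvPolynomial σ K] (ι → MvPolynomial σ K)),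
      IsHomogMap deg' deg φ ∧ LinearMap.range φ = N ∧
        LinearMap.ker φ ≤ irrelevantSub σ (Fin r) K := by
  obtain ⟨r, deg', g, hg, hspan, hmin⟩ := hN.exists_minimal_generators
  exact ⟨r, deg', Fintype.linearCombination _ g, isHomogMap_linearCombination hg,
    (Fintype.range_linearCombination _ _).trans hspan,
    ker_linearCombination_le_irrelevantSub hg hmin⟩

/-- A graded submodule `sub ≤ 𝔪 F` of a graded free module `F = ⨁ₗ K[σ](-deg l)` of finite rank:
the state of the recursive construction of a minimal resolution. -/
structure MinimalSyzygies (σ K : Type*) [Field K] where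
  rank : ℕ
  deg : Fin rank → ℕ
  sub : Submodule (MvPolynomial σ K) (Fin rank → MvPolynomial σ K)
  graded : IsGradedSub deg sub
  sub_le : sub ≤ irrelevantSub σ (Fin rank) K

namespace MinimalSyzygies

variable [Finite σ] (S : MinimalSyzygies σ K)

lemma exists_next :
    ∃ (T : MinimalSyzygies σ K)
      (φ : (Fin T.rank → MvPolynomial σ K) →ₗ[MvPolynomial σ K] (Fin S.rank → MvPolynomial σ K)),
      IsHomogMap T.deg S.deg φ ∧ LinearMap.range φ = S.sub ∧ LinearMap.ker φ = T.sub := by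
  obtain ⟨r, deg', φ, hφ, hrange, hker⟩ := S.graded.exists_minimal_presentation
  exact ⟨⟨r, deg', LinearMap.ker φ, hφ.isGradedSub_ker, hker⟩, φ, hφ, hrange, rfl⟩

/-- The module of relations among chosen minimal homogeneous generators of `S.sub`. -/
def next : MinimalSyzygies σ K := S.exists_next.choose

/-- The map onto `S.sub` given by the chosen minimal homogeneous generators. -/
def map :
    (Fin S.next.rank → MvPolynomial σ K) →ₗ[MvPolynomial σ K] (Fin S.rank → MvPolynomial σ K) :=
  S.exists_next.choose_spec.choose

lemma isHomogMap_map : IsHomogMap S.next.deg S.deg S.map :=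
  S.exists_next.choose_spec.choose_spec.1

lemma range_map : LinearMap.range S.map = S.sub :=
  S.exists_next.choose_spec.choose_spec.2.1

lemma ker_map : LinearMap.ker S.map = S.next.sub :=
  S.exists_next.choose_spec.choose_spec.2.2

lemma exact_map : Function.Exact S.next.map S.map :=
  LinearMap.exact_iff.mpr (S.ker_map.trans S.next.range_map.symm)

/-- The iterated syzygy modules of `S.sub`. -/
def syzygies : ℕ → MinimalSyzygies σ K
  | 0 => S
  | i + 1 => (syzygies i).next

attribute [local instance] MvPolynomial.gradedAlgebra

/-- A homogeneous ideal inside the ideal of the indeterminates, as a submodule of the free module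
of rank one. -/
def ofIdeal {I : Ideal (MvPolynomial σ K)} (hI : I.IsHomogeneous (homogeneousSubmodule σ K))
    (hconst : I ≤ RingHom.ker constantCoeff) : MinimalSyzygies σ K where
  rank := 1
  deg _ := 0
  sub := Submodule.comap (LinearMap.proj 0) I
  graded v hv j := by
    have hcomp : homogComp (fun _ => 0) j v (0 : Fin 1) = homogeneousComponent j (v 0) := by
      ext s
      rw [coeff_homogComp, coeff_homogeneousComponent, add_zero]
    rw [Submodule.mem_comap, LinearMap.proj_apply, hcomp]
    exact homogeneousComponent_mem_of_mem hI hv j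
  sub_le v hv := mem_irrelevantSub.mpr fun l => by
    rw [Subsingleton.elim l 0]
    exact hconst hv

lemma exact_ofIdeal_map {I : Ideal (MvPolynomial σ K)}
    (hI : I.IsHomogeneous (homogeneousSubmodule σ K)) (hconst : I ≤ RingHom.ker constantCoeff) :
    Function.Exact (ofIdeal hI hconst).map (I.mkQ ∘ₗ LinearMap.proj (0 : Fin 1)) := fun v =>
  (Submodule.Quotient.mk_eq_zero I).trans (SetLike.ext_iff.mp (ofIdeal hI hconst).range_map v).symm

end MinimalSyzygies

attribute [local instance] MvPolynomial.gradedAlgebra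

lemma nonempty_minimalGradedFreeResolution {n : ℕ} {I : Ideal (MvPolynomial (Fin n) K)}
    (hI : I.IsHomogeneous (homogeneousSubmodule (Fin n) K))
    (hconst : I ≤ RingHom.ker constantCoeff) : Nonempty (MinimalGradedFreeResolution I) := by
  let S := (MinimalSyzygies.ofIdeal hI hconst).syzygies
  refine ⟨{
    rank := fun i => (S i).rank
    deg := fun i => (S i).deg
    d := fun i => (S i).map
    aug := I.mkQ ∘ₗ LinearMap.proj (0 : Fin 1)
    d_homogeneous := fun i => (S i).isHomogMap_map
    aug_homogeneous := fun k => ⟨1, isHomogeneous_one _ _, ?_⟩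
    exact := fun i => (S i).exact_map
    exact_aug := MinimalSyzygies.exact_ofIdeal_map hI hconst
    aug_surjective := I.mkQ_surjective.comp (LinearMap.proj_surjective 0)
    minimal := fun i k => mem_irrelevantSub.mp ((S i).sub_le ?_) }⟩
  · rw [Subsingleton.elim (α := Fin 1) k 0]
    rfl
  · rw [← (S i).range_map]
    exact LinearMap.mem_range_self _ _

end GradedSubmodule

/-! ### Betti numbers of monomial ideals -/

section MonomialPresentation

open MvPolynomial

variable {σ α ι R : Type*}

section Semiring

variable [CommSemiring R] [Fintype α]

variable (ι R) in
/-- The map `R[σ]^α → R[σ]^ι` with all entries in the column of `a` equal to `x ^ e a`. For a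
one-element `ι` it presents the monomial ideal generated by the `x ^ e a`; allowing other names of
the one index avoids a transport to the first module of a resolution. -/
def monomialMap (e : α → σ →₀ ℕ) :
    (α → MvPolynomial σ R) →ₗ[MvPolynomial σ R] (ι → MvPolynomial σ R) :=
  Fintype.linearCombination _ fun a _ => monomial (e a) 1

lemma monomialMap_apply (e : α → σ →₀ ℕ) (y : α → MvPolynomial σ R) (l : ι) :
    monomialMap ι R e y l = ∑ a, y a * monomial (e a) 1 := by
  simp [monomialMap, Fintype.linearCombination_apply]

lemma isHomogMap_monomialMap [DecidableEq α] (e : α → σ →₀ ℕ) :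
    IsHomogMap (fun a => (e a).degree) (fun _ => 0) (monomialMap ι R e) :=
  isHomogMap_linearCombination fun a _ s hs => by
    rw [Finset.mem_singleton.mp (support_monomial_subset hs), add_zero]

lemma mem_range_monomialMap [Unique ι] {e : α → σ →₀ ℕ} {v : ι → MvPolynomial σ R} :
    v ∈ LinearMap.range (monomialMap ι R e) ↔
      v default ∈ Ideal.span (Set.range fun a => monomial (e a) (1 : R)) := by
  rw [Ideal.span, Submodule.mem_span_range_iff_exists_fun]
  refine exists_congr fun y => ?_
  rw [funext_iff, Unique.forall_iff, monomialMap_apply]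
  rfl

lemma isLeast_nonzeroDegrees_range_monomialMap [Nontrivial R] [Unique ι]
    {e : α → σ →₀ ℕ} {d : ℕ} (hd : IsLeast (Set.range fun a => (e a).degree) d) :
    IsLeast (nonzeroDegrees (fun _ => 0) (LinearMap.range (monomialMap ι R e))) d := by
  classical
  obtain ⟨⟨a, rfl⟩, hmin⟩ := hd
  refine ⟨⟨_, ⟨Pi.single a 1, rfl⟩, ?_, isHomogMap_monomialMap e a⟩, ?_⟩
  · refine Function.ne_iff.mpr ⟨default, ?_⟩
    simp [monomialMap, Fintype.linearCombination_apply_single]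
  · rintro j ⟨v, hv, hv0, hvj⟩
    obtain ⟨l, hl⟩ := Function.ne_iff.mp hv0
    obtain ⟨s, hs⟩ := support_nonempty.mpr hl
    rw [mem_range_monomialMap, ← Unique.eq_default l, ← Function.comp_def (monomial · (1 : R)) e,
      Set.range_comp, mem_ideal_span_monomial_image] at hv
    obtain ⟨_, ⟨b, rfl⟩, hb⟩ := hv s hs
    have hsj := hvj l s hs
    exact (hmin ⟨b, rfl⟩).trans ((Finsupp.degree_mono hb).trans hsj.le)

/-- In a relation every term `r x ^ u · x ^ e a` is cancelled by a term of another generator. -/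
lemma exists_ne_le_add_of_mem_ker_monomialMap [Nonempty ι] {e : α → σ →₀ ℕ}
    {y : α → MvPolynomial σ R} (hy : y ∈ LinearMap.ker (monomialMap ι R e)) {a : α} {u : σ →₀ ℕ}
    (hu : u ∈ (y a).support) : ∃ b, b ≠ a ∧ e b ≤ u + e a := by
  by_contra! h
  have hcoeff := congrArg (coeff (u + e a)) (congrFun hy (Classical.arbitrary ι))
  rw [monomialMap_apply, coeff_sum, Finset.sum_eq_single a ?_ (by simp), coeff_mul_monomial,
    mul_one] at hcoeff
  · exact mem_support_iff.mp hu hcoeff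
  · intro b _ hba
    rw [coeff_mul_monomial', if_neg (h b hba)]

lemma ker_monomialMap_le_irrelevantSub [Nonempty ι] {e : α → σ →₀ ℕ}
    (he : ∀ a b, e a ≤ e b → a = b) :
    LinearMap.ker (monomialMap ι R e) ≤ irrelevantSub σ α R := by
  refine fun y hy => mem_irrelevantSub.mpr fun a => ?_
  by_contra ha
  obtain ⟨b, hba, hle⟩ := exists_ne_le_add_of_mem_ker_monomialMap hy (mem_support_iff.mpr ha)
  exact hba (he b a (by rwa [zero_add] at hle))

end Semiring

lemma isLeast_nonzeroDegrees_ker_monomialMap [CommRing R] [Nontrivial R] [Fintype α] [Nonempty ι]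
    {e : α → σ →₀ ℕ} {d : ℕ}
    (hd : IsLeast {j | ∃ a b, a ≠ b ∧ (e a ⊔ e b).degree = j} d) :
    IsLeast (nonzeroDegrees (fun a => (e a).degree)
      (LinearMap.ker (monomialMap ι R e))) d := by
  classical
  obtain ⟨⟨a, b, hab, rfl⟩, hmin⟩ := hd
  refine ⟨⟨Pi.single a (monomial (e a ⊔ e b - e a) 1) - Pi.single b (monomial (e a ⊔ e b - e b) 1),
    ?_, ?_, ?_⟩, ?_⟩
  · rw [LinearMap.mem_ker, map_sub, sub_eq_zero, monomialMap,
      Fintype.linearCombination_apply_single, Fintype.linearCombination_apply_single]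
    ext1 l
    simp only [Pi.smul_apply, smul_eq_mul, monomial_mul, mul_one,
      tsub_add_cancel_of_le (le_sup_left : e a ≤ e a ⊔ e b),
      tsub_add_cancel_of_le (le_sup_right : e b ≤ e a ⊔ e b)]
  · refine Function.ne_iff.mpr ⟨a, ?_⟩
    simp [hab]
  · have hdeg {c : α} (hc : e c ≤ e a ⊔ e b) : IsHomogVec (fun a => (e a).degree)
        (e a ⊔ e b).degree (Pi.single c (monomial (e a ⊔ e b - e c) (1 : R))) := by
      have h := isHomogVec_single_monomial (fun a => (e a).degree) c (e a ⊔ e b - e c) (1 : R)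
      rwa [← map_add, tsub_add_cancel_of_le hc] at h
    exact (hdeg le_sup_left).sub (hdeg le_sup_right)
  · rintro j ⟨y, hy, hy0, hyj⟩
    obtain ⟨c, hc⟩ := Function.ne_iff.mp hy0
    obtain ⟨u, hu⟩ := support_nonempty.mpr hc
    obtain ⟨c', hc', hle⟩ := exists_ne_le_add_of_mem_ker_monomialMap hy hu
    have hdeg := Finsupp.degree_mono (sup_le le_add_self hle : e c ⊔ e c' ≤ u + e c)
    rw [map_add, hyj c u hu] at hdeg
    exact (hmin ⟨c, c', hc'.symm, rfl⟩).trans hdeg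

end MonomialPresentation

namespace MinimalGradedFreeResolution

open MvPolynomial

variable {K : Type*} [Field K] {n : ℕ} {I : Ideal (MvPolynomial (Fin n) K)}
  (P : MinimalGradedFreeResolution I)

lemma isHomogMap_d (i : ℕ) : IsHomogMap (P.deg (i + 1)) (P.deg i) (P.d i) :=
  P.d_homogeneous i

lemma betti_ne_zero_iff {i j : ℕ} : P.betti i j ≠ 0 ↔ ∃ k, P.deg i k = j := by
  simp [betti, Finset.card_eq_zero, Finset.filter_eq_empty_iff]

lemma d_mem_irrelevantSub (i : ℕ) (z : Fin (P.rank (i + 1)) → MvPolynomial (Fin n) K) :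
    P.d i z ∈ irrelevantSub (Fin n) (Fin (P.rank i)) K := by
  rw [map_eq_sum_smul]
  exact Submodule.sum_mem _ fun k _ => Submodule.smul_mem _ _
    (mem_irrelevantSub.mpr (P.minimal i k))

lemma ker_d_le_irrelevantSub (i : ℕ) :
    LinearMap.ker (P.d i) ≤ irrelevantSub (Fin n) (Fin (P.rank (i + 1))) K := by
  intro z hz
  obtain ⟨y, rfl⟩ := (P.exact i z).mp hz
  exact P.d_mem_irrelevantSub (i + 1) y

lemma d_single_ne_zero (i : ℕ) (k : Fin (P.rank (i + 1))) : P.d i (Pi.single k 1) ≠ 0 := by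
  intro h
  have hconst := mem_irrelevantSub.mp (P.ker_d_le_irrelevantSub i h) k
  simp at hconst

lemma isLeast_betti_succ {i d : ℕ}
    (hd : IsLeast (nonzeroDegrees (P.deg i) (LinearMap.range (P.d i))) d) :
    IsLeast {j | P.betti (i + 1) j ≠ 0} d := by
  have hdeg (k) : d ≤ P.deg (i + 1) k :=
    hd.2 ⟨_, LinearMap.mem_range_self _ _, P.d_single_ne_zero i k, P.isHomogMap_d i k⟩
  simp only [betti_ne_zero_iff]
  obtain ⟨k, hk⟩ := (P.isHomogMap_d i).exists_deg_le hd.1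
  refine ⟨⟨k, hk.antisymm (hdeg k)⟩, ?_⟩
  rintro _ ⟨l, rfl⟩
  exact hdeg l

lemma exists_generator (hI : I ≤ RingHom.ker constantCoeff) :
    ∃ k₀, P.deg 0 k₀ = 0 ∧ ∃ c ≠ 0, P.aug (Pi.single k₀ 1) = Ideal.Quotient.mk I (C c) := by
  choose p hp haug using P.aug_homogeneous
  obtain ⟨v, hv⟩ := P.aug_surjective (Ideal.Quotient.mk I 1)
  have hone : constantCoeff (∑ k, v k * p k) = 1 := by
    rw [map_eq_sum_smul, Finset.sum_congr rfl fun k _ => congrArg (v k • ·) (haug k)] at hv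
    have hmem : (∑ k, v k * p k) - 1 ∈ I := by
      rw [← Ideal.Quotient.eq, ← hv, map_sum]
      rfl
    simpa [sub_eq_zero] using hI hmem
  obtain ⟨k₀, -, hk₀⟩ := Finset.exists_ne_zero_of_sum_ne_zero
    ((map_sum _ _ _).symm.trans_ne (hone.trans_ne one_ne_zero))
  rw [map_mul] at hk₀
  have hc := right_ne_zero_of_mul hk₀
  have hdeg : P.deg 0 k₀ = 0 := by
    by_contra h
    exact hc ((hp k₀).coeff_eq_zero (by simpa using Ne.symm h))
  refine ⟨k₀, hdeg, _, hc, ?_⟩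
  rw [haug, constantCoeff_eq, ← totalDegree_eq_zero_iff_eq_C.mp
    (Nat.le_zero.mp (hdeg ▸ (hp k₀).totalDegree_le))]

lemma eq_of_aug_single_eq_const {k₀ : Fin (P.rank 0)} {c : K} (hc : c ≠ 0)
    (hk₀ : P.aug (Pi.single k₀ 1) = Ideal.Quotient.mk I (C c)) (k : Fin (P.rank 0)) : k = k₀ := by
  by_contra hk
  obtain ⟨p, -, hp⟩ := P.aug_homogeneous k
  have hker : P.aug (C c • Pi.single k 1 - p • Pi.single k₀ 1) = 0 := by
    rw [map_sub, map_smul, map_smul, hk₀, hp, sub_eq_zero]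
    exact congrArg (Ideal.Quotient.mk I) (mul_comm _ _)
  obtain ⟨x, hx⟩ := (P.exact_aug _).mp hker
  have hconst := mem_irrelevantSub.mp (P.d_mem_irrelevantSub 0 x) k
  rw [hx] at hconst
  simp [hk, hc] at hconst

lemma rank_zero (hI : I ≤ RingHom.ker constantCoeff) : P.rank 0 = 1 := by
  obtain ⟨k₀, -, c, hc, hk₀⟩ := P.exists_generator hI
  rw [← Fintype.card_fin (P.rank 0), Fintype.card_eq_one_iff]
  exact ⟨k₀, P.eq_of_aug_single_eq_const hc hk₀⟩

lemma deg_zero (hI : I ≤ RingHom.ker constantCoeff) : P.deg 0 = fun _ => 0 := by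
  obtain ⟨k₀, hdeg, c, hc, hk₀⟩ := P.exists_generator hI
  exact funext fun k => by rw [P.eq_of_aug_single_eq_const hc hk₀ k, hdeg]

lemma mem_range_d_zero (hI : I ≤ RingHom.ker constantCoeff)
    {v : Fin (P.rank 0) → MvPolynomial (Fin n) K} :
    v ∈ LinearMap.range (P.d 0) ↔ ∀ k, v k ∈ I := by
  obtain ⟨k₀, -, c, hc, hk₀⟩ := P.exists_generator hI
  have huniq := P.eq_of_aug_single_eq_const hc hk₀
  have haug : P.aug v = Ideal.Quotient.mk I (v k₀ * C c) := by
    rw [map_eq_sum_smul, Finset.sum_eq_single k₀ (fun k _ hk => (hk (huniq k)).elim) (by simp), hk₀]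
    rfl
  rw [← (LinearMap.exact_iff.mp P.exact_aug), LinearMap.mem_ker, haug,
    Ideal.Quotient.eq_zero_iff_mem,
    Ideal.mul_unit_mem_iff_mem I ((isUnit_iff_ne_zero.mpr hc).map C)]
  exact ⟨fun h k => huniq k ▸ h, fun h => h k₀⟩

section Monomial

variable {α : Type*} {e : α → Fin n →₀ ℕ}

lemma range_d_zero_eq_range_monomialMap [Fintype α] (hI : I ≤ RingHom.ker constantCoeff)
    (he : I = Ideal.span (Set.range fun a => monomial (e a) (1 : K)))
    [Unique (Fin (P.rank 0))] :
    LinearMap.range (P.d 0) = LinearMap.range (monomialMap (Fin (P.rank 0)) K e) := by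
  ext v
  rw [P.mem_range_d_zero hI, mem_range_monomialMap, ← he, Unique.forall_iff]

lemma isLeast_betti_one [Finite α] (hI : I ≤ RingHom.ker constantCoeff)
    (he : I = Ideal.span (Set.range fun a => monomial (e a) (1 : K))) {d : ℕ}
    (hd : IsLeast (Set.range fun a => (e a).degree) d) : IsLeast {j | P.betti 1 j ≠ 0} d := by
  classical
  cases nonempty_fintype α
  have := (finCongr (P.rank_zero hI)).unique
  apply P.isLeast_betti_succ
  rw [P.deg_zero hI, P.range_d_zero_eq_range_monomialMap hI he]
  exact isLeast_nonzeroDegrees_range_monomialMap hd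

lemma isLeast_betti_two [Finite α] (hI : I ≤ RingHom.ker constantCoeff)
    (he : I = Ideal.span (Set.range fun a => monomial (e a) (1 : K)))
    (hanti : ∀ a b, e a ≤ e b → a = b) {d : ℕ}
    (hd : IsLeast {j | ∃ a b, a ≠ b ∧ (e a ⊔ e b).degree = j} d) :
    IsLeast {j | P.betti 2 j ≠ 0} d := by
  classical
  cases nonempty_fintype α
  have := (finCongr (P.rank_zero hI)).unique
  have hmap := isHomogMap_monomialMap (ι := Fin (P.rank 0)) (R := K) e
  have hhom := P.isHomogMap_d 0
  rw [P.deg_zero hI] at hhom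
  have hrange := P.range_d_zero_eq_range_monomialMap hI he
  apply P.isLeast_betti_succ
  rw [← LinearMap.exact_iff.mp (P.exact 0),
    (nonzeroDegrees_ker_subset hmap hhom hrange (P.ker_d_le_irrelevantSub 0)).antisymm
      (nonzeroDegrees_ker_subset hhom hmap hrange.symm (ker_monomialMap_le_irrelevantSub hanti))]
  exact isLeast_nonzeroDegrees_ker_monomialMap hd

end Monomial

end MinimalGradedFreeResolution

section SupportIdeal

open MvPolynomial

variable {n : ℕ}

/-- The exponent vector of the square-free monomial with support `S`. -/
def setExpo (S : Finset (Fin n)) : Fin n →₀ ℕ := ∑ i ∈ S, Finsupp.single i 1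

lemma setExpo_apply (S : Finset (Fin n)) (i : Fin n) :
    setExpo S i = if i ∈ S then 1 else 0 := by
  simp [setExpo, Finsupp.finsetSum_apply, Finsupp.single_apply]

lemma degree_setExpo (S : Finset (Fin n)) : (setExpo S).degree = S.card := by
  simp [setExpo]

lemma setExpo_sup (S T : Finset (Fin n)) : setExpo S ⊔ setExpo T = setExpo (S ∪ T) := by
  ext i
  by_cases hS : i ∈ S <;> by_cases hT : i ∈ T <;> simp [setExpo_apply, hS, hT]

lemma setExpo_le_iff {S T : Finset (Fin n)} : setExpo S ≤ setExpo T ↔ S ⊆ T := by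
  refine forall_congr' fun i => ?_
  by_cases hS : i ∈ S <;> by_cases hT : i ∈ T <;> simp [setExpo_apply, hS, hT]

lemma prod_X_eq_monomial (K : Type*) [Field K] (S : Finset (Fin n)) :
    ∏ i ∈ S, (X i : MvPolynomial (Fin n) K) = monomial (setExpo S) 1 := by
  rw [setExpo, monomial_sum_one]
  rfl

variable {F K : Type*} [Field F] [Field K] {M : Set (Fin n → F)}

variable (K M) in
lemma supportIdeal_eq_span :
    supportIdeal K M = Ideal.span (Set.range fun S : ↥(supp '' M) => monomial (setExpo S.1) 1) := by
  simp only [supportIdeal, prod_X_eq_monomial]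
  congr 1
  ext t
  simp [eq_comm]

attribute [local instance] MvPolynomial.gradedAlgebra

variable (K M) in
lemma isHomogeneous_supportIdeal :
    (supportIdeal K M).IsHomogeneous (homogeneousSubmodule (Fin n) K) := by
  rw [supportIdeal_eq_span]
  refine Ideal.homogeneous_span _ _ ?_
  rintro _ ⟨S, rfl⟩
  exact ⟨_, isHomogeneous_monomial _ rfl⟩

lemma supportIdeal_le_ker_constantCoeff (hM : ∀ c ∈ M, c ≠ 0) :
    supportIdeal K M ≤ RingHom.ker constantCoeff := by
  refine Ideal.span_le.mpr ?_
  rintro _ ⟨c, hc, rfl⟩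
  obtain ⟨i, hi⟩ := supp_nonempty (hM c hc)
  rw [SetLike.mem_coe, RingHom.mem_ker, map_prod]
  exact Finset.prod_eq_zero hi (constantCoeff_X _ i)

lemma isLeast_betti_one_supportIdeal (P : MinimalGradedFreeResolution (supportIdeal K M))
    (hM : ∀ c ∈ M, c ≠ 0) {d : ℕ} (hd : IsLeast (Finset.card '' (supp '' M)) d) :
    IsLeast {j | P.betti 1 j ≠ 0} d := by
  refine P.isLeast_betti_one (supportIdeal_le_ker_constantCoeff hM) (supportIdeal_eq_span K M) ?_
  rw [Set.image_eq_range] at hd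
  simpa only [degree_setExpo] using hd

lemma isLeast_betti_two_supportIdeal (P : MinimalGradedFreeResolution (supportIdeal K M))
    (hM : ∀ c ∈ M, c ≠ 0) (hanti : IsAntichain (· ⊆ ·) (supp '' M)) {d : ℕ}
    (hd : IsLeast {d | ∃ S ∈ supp '' M, ∃ T ∈ supp '' M, S ≠ T ∧ (S ∪ T).card = d} d) :
    IsLeast {j | P.betti 2 j ≠ 0} d := by
  refine P.isLeast_betti_two (supportIdeal_le_ker_constantCoeff hM) (supportIdeal_eq_span K M)
    (fun S T hST => Subtype.ext (hanti.eq S.2 T.2 (setExpo_le_iff.mp hST))) ?_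
  simpa only [setExpo_sup, degree_setExpo, Subtype.exists, ne_eq, Subtype.mk.injEq, exists_prop,
    and_assoc, exists_and_left] using hd

end SupportIdeal

lemma isAntichain_supp_image_minSupportWords {F : Type*} [Field F] {n : ℕ}
    (C : Submodule F (Fin n → F)) : IsAntichain (· ⊆ ·) (supp '' minSupportWords C) := by
  rintro _ ⟨c, ⟨hc, hc0, -⟩, rfl⟩ _ ⟨c', ⟨-, -, hmin⟩, rfl⟩ hne hsub
  exact hmin c hc hc0 (hsub.ssubset_of_ne hne)

end

end LinearCodeBetti

theorem corollary6p3_general {F K : Type*} [Field F] [Finite F] [Field K] {n : ℕ}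
    (C : Submodule F (Fin n → F)) (hC : 1 ≤ Module.finrank F C)
    (ord : MonomialOrder (Fin n × Fˣ)) (hdeg : DegreeCompatible ord)
    (G : Set (MvPolynomial (Fin n × Fˣ) K))
    (hG : IsReducedGroebnerBasis ord (codeIdeal K C) G) :
    Nonempty (MinimalGradedFreeResolution (supportIdeal K (groebnerWords ord C G))) ∧
    ∀ P : MinimalGradedFreeResolution (supportIdeal K (groebnerWords ord C G)),
      IsLeast {j | P.betti 1 j ≠ 0} (ghw C 1) ∧
      (2 ≤ Module.finrank F C → NegCompatible ord →
        ∀ m₁ m₂ : Fin n → F, IsLeastWord ord (firstWords C) m₁ →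
          IsLeastWord ord (secondWords C m₁) m₂ →
          ((supp m₁ ∩ supp m₂).card : ℚ) ≤ ((supp m₂).card + 1) / 2 →
          IsLeast {j | P.betti 2 j ≠ 0} (ghw C 2)) := by
  have hne_zero : ∀ c ∈ groebnerWords ord C G, c ≠ 0 := fun c hc => hc.2.2.1
  have hanti : IsAntichain (· ⊆ ·) (supp '' groebnerWords ord C G) :=
    (isAntichain_supp_image_minSupportWords C).subset (Set.image_mono Set.inter_subset_right)
  refine ⟨nonempty_minimalGradedFreeResolution (isHomogeneous_supportIdeal K _)
    (supportIdeal_le_ker_constantCoeff hne_zero), fun P => ⟨?_, ?_⟩⟩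
  · exact isLeast_betti_one_supportIdeal P hne_zero (isLeast_card_supp_groebnerWords hC hdeg hG)
  · intro hC₂ hneg m₁ m₂ hm₁ hm₂ hinter
    refine isLeast_betti_two_supportIdeal P hne_zero hanti
      (isLeast_card_union_supp_groebnerWords hC₂ hdeg hneg hG hm₁ hm₂ ?_)
    exact_mod_cast (by linarith :
      (2 : ℚ) * (supp m₁ ∩ supp m₂).card ≤ (supp m₂).card + 1)

theorem corollary6p3 {F K : Type*} [Field F] [Finite F] [Field K] {n : ℕ}
    (C : Submodule F (Fin n → F)) (hC : 1 ≤ Module.finrank F C)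
    (ord : MonomialOrder (Fin n × Fˣ))
    (hdeg : DegreeCompatible ord) (hblock : BlockDecreasing ord)
    (G : Set (MvPolynomial (Fin n × Fˣ) K))
    (hG : IsReducedGroebnerBasis ord (codeIdeal K C) G) :
    Nonempty (MinimalGradedFreeResolution (supportIdeal K (groebnerWords ord C G))) ∧
    ∀ P : MinimalGradedFreeResolution (supportIdeal K (groebnerWords ord C G)),
      IsLeast {j | P.betti 1 j ≠ 0} (ghw C 1) ∧
      (2 ≤ Module.finrank F C → NegCompatible ord →
        ∀ m₁ m₂ : Fin n → F, IsLeastWord ord (firstWords C) m₁ →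
          IsLeastWord ord (secondWords C m₁) m₂ →
          ((supp m₁ ∩ supp m₂).card : ℚ) ≤ ((supp m₂).card + 1) / 2 →
          IsLeast {j | P.betti 2 j ≠ 0} (ghw C 2)) :=
  corollary6p3_general C hC ord hdeg G hG
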